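/- Let $\mathcal E$ be a real (complete) countably-Hilbert space whose topology is given by compatible inner product norms $(|\cdot|_p)_{p\ge 0}$; let $\mathcal E_p$ be the completion of $\mathcal E$ for $|\cdot|_p$. Assume that there is $0<\rho<1$ with $|\cdot|_p\le\rho\,|\cdot|_{p+1}$ for all integers $p\ge0$, and that for each $p$ there is $q>p$ such that the inclusion $\mathcal E_q\to\mathcal E_p$ is Hilbert-Schmidt with Hilbert-Schmidt norm $<1$. Let $\mathcal E_c$ be the complexification of $\mathcal E$, extend $\langle\cdot,\cdot\rangle_0$ bilinearly to $\mathcal E_c$, and let $|\cdot|_{-p}$ be the norm of the dual of $\mathcal E_p$ (and of its complexification), where $\xi\in\mathcal E$ acts on $\mathcal E$ as $\langle\xi,\cdot\rangle_0$. Let $\mu$ be the standard Gaussian measure on the dual space $\mathcal E'$, $\int e^{i\langle x,\xi\rangle}d\mu(x)=e^{-|\xi|_0^2/2}$, and let $(L^2)=L^2(\mathcal E',\mu;\mathbb C)$. Each $\varphi\in(L^2)$ has a Wiener-Itô expansion $\varphi=\sum_n I_n(f_n)$ with $f_n$ in the complexification of the symmetric Hilbert tensor power $\mathcal E_0^{\widehat\otimes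 n}$. Let $(\alpha(n))_{n\ge0}$ be real numbers satisfying (A1): $\alpha(0)=1$ and $\inf_n\alpha(n)>0$. Put $[\mathcal E]_\alpha=\{\varphi\in(L^2):\ \sum_n n!\,\alpha(n)|f_n|_p^2<\infty\ \text{for all } p\ge0\}$ (where $|f_n|_p=\infty$ if $f_n$ does not lie in the complexification of $\mathcal E_p^{\otimes n}$), $G_{1/\alpha}(r)=\sum_n \frac{r^n}{n!\,\alpha(n)}$, and for $\varphi\in(L^2)$ and $\xi\in\mathcal E_c$, $$S\varphi(\xi)=\int_{\mathcal E'}\varphi(x)\,{:}e^{\langle x,\xi\rangle}{:}\,d\mu(x),\qquad {:}e^{\langle x,\xi\rangle}{:}=\sum_n\frac1{n!}\langle{:}x^{\otimes n}{:},\xi^{\otimes n}\rangle .$$ **(I)** If $\varphi\in[\mathcal E]_\alpha$, then $F=S\varphi$ satisfies 1. for all $\xi,\eta\in\mathcal E_c$, the function $z\mapsto F(z\xi+\eta)$ is entire on $\mathbb C$; 2. for every real $a>0$ and every integer $p\ge0$ there is $K\ge0$ such that $|F(\xi)|\le K\,G_{1/\alpha}\big(a|\xi|_{-p}^2\big)^{1/2}$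 for all $\xi\in\mathcal E_c$. **(II)** Conversely, assume condition ($\widetilde{\mathrm B}1$): $\limsup_{n\to\infty}\big(n!\,\alpha(n)\inf_{r>0}r^{-n}G_{1/\alpha}(r)\big)^{1/n}<\infty$. Then for every function $F:\mathcal E_c\to\mathbb C$ satisfying 1 and 2 there is a unique $\varphi\in[\mathcal E]_\alpha$ with $F=S\varphi$. -/

import Mathlib

open MeasureTheory Filter Topology
open scoped ENNReal

set_option linter.unusedSectionVars false

noncomputable section

namespace CKS

/-- A real (complete) countably-Hilbert space: the topology of `E` is given by a sequence of
inner products `ip p`, the norms being compatible.  (Completeness is the type class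
`CompleteSpace E` in the theorem.) -/
structure CountablyHilbert (E : Type*) [AddCommGroup E] [Module ℝ E] [UniformSpace E] where
  /-- the `p`-th inner product -/
  ip : ℕ → LinearMap.BilinForm ℝ E
  symm : ∀ p ξ η, ip p ξ η = ip p η ξ
  pos : ∀ p ξ, ξ ≠ 0 → 0 < ip p ξ ξ
  /-- neighbourhoods of `0` are the sets containing a ball of finitely many of the norms -/
  nhds_zero : ∀ s : Set E, s ∈ 𝓝 (0 : E) ↔
    ∃ (N : ℕ) (ε : ℝ), 0 < ε ∧ ∀ ξ : E, (∀ p ≤ N, Real.sqrt (ip p ξ ξ) < ε) → ξ ∈ s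
  /-- compatibility of the norms, that is, injectivity of the canonical maps between the
  completions: a sequence which is Cauchy for the `q`-th norm and tends to `0` for the `p`-th
  norm tends to `0` for the `q`-th norm -/
  compatible : ∀ (p q : ℕ) (u : ℕ → E),
    (∀ ε > 0, ∃ N, ∀ m ≥ N, ∀ n ≥ N, Real.sqrt (ip q (u m - u n) (u m - u n)) < ε) →
    Tendsto (fun n => Real.sqrt (ip p (u n) (u n))) atTop (𝓝 0) →
    Tendsto (fun n => Real.sqrt (ip q (u n) (u n))) atTop (𝓝 0)

/-! ### The complexification `E_c` -/

/-- The complexification of a real vector space; the pair `(u, v)` stands for `u + i v`. -/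
def Complexify (E : Type*) : Type _ := E × E

namespace Complexify

variable {E : Type*} [AddCommGroup E] [Module ℝ E]

/-- real part -/
def re (ξ : Complexify E) : E := ξ.1

/-- imaginary part -/
def im (ξ : Complexify E) : E := ξ.2

/-- the element `u + i v` -/
def mk (u v : E) : Complexify E := (u, v)

/-- the inclusion `E ⊂ E_c` -/
def ofReal (u : E) : Complexify E := mk u 0

@[ext] theorem ext {ξ η : Complexify E} (h₁ : ξ.re = η.re) (h₂ : ξ.im = η.im) : ξ = η :=
  Prod.ext h₁ h₂

instance : AddCommGroup (Complexify E) := inferInstanceAs (AddCommGroup (E × E))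

instance : SMul ℂ (Complexify E) :=
  ⟨fun z ξ => mk (z.re • ξ.re - z.im • ξ.im) (z.re • ξ.im + z.im • ξ.re)⟩

@[simp] theorem mk_re (u v : E) : (mk u v).re = u := rfl
@[simp] theorem mk_im (u v : E) : (mk u v).im = v := rfl
@[simp] theorem zero_re : (0 : Complexify E).re = 0 := rfl
@[simp] theorem zero_im : (0 : Complexify E).im = 0 := rfl
@[simp] theorem add_re (ξ η : Complexify E) : (ξ + η).re = ξ.re + η.re := rfl
@[simp] theorem add_im (ξ η : Complexify E) : (ξ + η).im = ξ.im + η.im := rfl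
@[simp] theorem smul_re (z : ℂ) (ξ : Complexify E) :
    (z • ξ).re = z.re • ξ.re - z.im • ξ.im := rfl
@[simp] theorem smul_im (z : ℂ) (ξ : Complexify E) :
    (z • ξ).im = z.re • ξ.im + z.im • ξ.re := rfl

instance : Module ℂ (Complexify E) where
  one_smul ξ := by ext <;> simp
  mul_smul z w ξ := by
    ext
    · simp only [smul_re, smul_im, Complex.mul_re, Complex.mul_im]; module
    · simp only [smul_re, smul_im, Complex.mul_re, Complex.mul_im]; module
  smul_zero z := by ext <;> simp
  smul_add z ξ η := by
    ext
    · simp only [smul_re, add_re, add_im]; module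
    · simp only [smul_im, add_re, add_im]; module
  add_smul z w ξ := by
    ext
    · simp only [smul_re, add_re, Complex.add_re, Complex.add_im]; module
    · simp only [smul_im, add_im, Complex.add_re, Complex.add_im]; module
  zero_smul ξ := by ext <;> simp

end Complexify

namespace CountablyHilbert

variable {E : Type*} [AddCommGroup E] [Module ℝ E] [UniformSpace E] (H : CountablyHilbert E)

/-! ### Norms -/

/-- `|ξ|_p` for `ξ ∈ E` -/
def norm (p : ℕ) (ξ : E) : ℝ := Real.sqrt (H.ip p ξ ξ)

/-- `|ξ|_{-p}` for `ξ ∈ E ⊂ E_p'`: the dual norm of the functional `η ↦ ⟨ξ, η⟩_0`. -/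
def negNorm (p : ℕ) (ξ : E) : ℝ :=
  sSup {t : ℝ | ∃ η : E, H.norm p η ≤ 1 ∧ t = |H.ip 0 ξ η|}

/-- `|ξ|_{-p}` for `ξ ∈ E_c` -/
def cnegNorm (p : ℕ) (ξ : Complexify E) : ℝ :=
  Real.sqrt (H.negNorm p ξ.re ^ 2 + H.negNorm p ξ.im ^ 2)

/-- `‖i_{q,p}‖_{HS}²` for the canonical map `i_{q,p} : E_q → E_p`, in `[0, ∞]`: the supremum of
`∑ |e_j|_p²` over the finite `⟨·,·⟩_q`-orthonormal families, which may be taken in the dense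
subspace `E` of the completion `E_q`. -/
def hsNormSq (q p : ℕ) : ℝ≥0∞ :=
  ⨆ (m : ℕ) (e : Fin m → E) (_ : ∀ j k, H.ip q (e j) (e k) = if j = k then 1 else 0),
    ∑ j, ENNReal.ofReal (H.norm p (e j) ^ 2)

/-- The complex bilinear extension to `E_c` of the inner product of `E_0`, as a linear functional
of the second variable. -/
def cpair (ξ : Complexify E) : Complexify E →ₗ[ℂ] ℂ where
  toFun η :=
    ⟨H.ip 0 ξ.re η.re - H.ip 0 ξ.im η.im, H.ip 0 ξ.re η.im + H.ip 0 ξ.im η.re⟩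
  map_add' η ζ := by
    apply Complex.ext
    · simp; ring
    · simp; ring
  map_smul' z η := by
    apply Complex.ext
    · simp; ring
    · simp; ring

/-! ### Symmetric Hilbert tensor powers

An element `f` of the complex Hilbert space tensor power `E_0^{⊗n}` is represented by the
multilinear form `(η_1, …, η_n) ↦ ⟨f, η_1 ⊗ ⋯ ⊗ η_n⟩` on `E_c`; the elements of the tensor power
are exactly the forms which are Hilbert-Schmidt. -/

/-- A finite family in `E` which is orthonormal for the Hilbert norm `|·|_{-p}`. -/
def IsNegOrthonormal (p : ℕ) {m : ℕ} (e : Fin m → E) : Prop :=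
  ∀ c : Fin m → ℝ, H.negNorm p (∑ j, c j • e j) ^ 2 = ∑ j, c j ^ 2

/-- `|f|_p² ∈ [0, ∞]`, the squared norm of `f` in `E_p^{⊗n} ⊂ E_0^{⊗n}`: the squared
Hilbert-Schmidt norm of the form `f` with respect to `|·|_{-p}`. -/
def tensorNormSq (p : ℕ) {n : ℕ}
    (f : MultilinearMap ℂ (fun _ : Fin n => Complexify E) ℂ) : ℝ≥0∞ :=
  ⨆ (m : ℕ) (e : Fin m → E) (_ : H.IsNegOrthonormal p e),
    ∑ i : Fin n → Fin m, ENNReal.ofReal (‖f (fun k => Complexify.ofReal (e (i k)))‖ ^ 2)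

/-- `f ∈ E_0^{⊗̂n}` (complex symmetric tensor power) -/
def IsSymTensor {n : ℕ} (f : MultilinearMap ℂ (fun _ : Fin n => Complexify E) ℂ) : Prop :=
  (∀ (σ : Equiv.Perm (Fin n)) (η : Fin n → Complexify E), f (fun k => η (σ k)) = f η) ∧
    H.tensorNormSq 0 f < ∞

/-- the elementary tensor `ξ^{⊗n}` -/
def tensorPow (n : ℕ) (ξ : Complexify E) :
    MultilinearMap ℂ (fun _ : Fin n => Complexify E) ℂ :=
  (MultilinearMap.mkPiAlgebra ℂ (Fin n) ℂ).compLinearMap (fun _ => H.cpair ξ)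

end CountablyHilbert

/-! ### Gaussian measure on the dual space -/

/-- The dual space `E'`. -/
def Dual (E : Type*) [AddCommGroup E] [Module ℝ E] [UniformSpace E] : Type _ := E →L[ℝ] ℝ

/-- The action of `x ∈ E'` on `E`. -/
def Dual.eval {E : Type*} [AddCommGroup E] [Module ℝ E] [UniformSpace E]
    (x : Dual E) (ξ : E) : ℝ :=
  (show E →L[ℝ] ℝ from x) ξ

/-- The `σ`-algebra on `E'` generated by the maps `x ↦ ⟨x, ξ⟩`, `ξ ∈ E`. -/
instance {E : Type*} [AddCommGroup E] [Module ℝ E] [UniformSpace E] : MeasurableSpace (Dual E) :=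
  ⨆ ξ : E, MeasurableSpace.comap (fun x : Dual E => x.eval ξ) (borel ℝ)

/-- `⟨x, ξ⟩` for `x ∈ E'`, `ξ ∈ E_c` -/
def Dual.ceval {E : Type*} [AddCommGroup E] [Module ℝ E] [UniformSpace E]
    (x : Dual E) (ξ : Complexify E) : ℂ :=
  ⟨x.eval ξ.re, x.eval ξ.im⟩

namespace CountablyHilbert

variable {E : Type*} [AddCommGroup E] [Module ℝ E] [UniformSpace E] (H : CountablyHilbert E)

/-- `μ` is the standard Gaussian measure on `E'`: the probability measure with characteristic
functional `ξ ↦ exp (- |ξ|_0² / 2)`. -/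
def IsStandardGaussian (μ : Measure (Dual E)) : Prop :=
  IsProbabilityMeasure μ ∧
    ∀ ξ : E, ∫ x, Complex.exp (Complex.I * (x.eval ξ : ℂ)) ∂μ =
      Complex.exp (-((H.norm 0 ξ : ℂ) ^ 2) / 2)

/-- The Wick power `⟨:x^{⊗n}:, ξ^{⊗n}⟩`, for `ξ ∈ E_c`. -/
def wickPow (n : ℕ) (ξ : Complexify E) (x : Dual E) : ℂ :=
  ∑ k ∈ Finset.range (n / 2 + 1),
    (-1 : ℂ) ^ k * ((n.factorial : ℂ) / ((k.factorial : ℂ) * ((n - 2 * k).factorial : ℂ) * 2 ^ k)) *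
      H.cpair ξ ξ ^ k * x.ceval ξ ^ (n - 2 * k)

/-- The renormalized exponential `:e^{⟨x, ξ⟩}: = ∑ (1 / n!) ⟨:x^{⊗n}:, ξ^{⊗n}⟩` (the series
converges absolutely for every `x`). -/
def wickExp (ξ : Complexify E) (x : Dual E) : ℂ :=
  ∑' n : ℕ, (1 / (n.factorial : ℂ)) * H.wickPow n ξ x

/-- `φ = I_n(f)` in `(L²)`: the multiple Wiener integral is the continuous linear extension to
`E_0^{⊗̂n}` of the map sending finite sums `∑ c_j ξ_j^{⊗n}` to `∑ c_j ⟨:x^{⊗n}:, ξ_j^{⊗n}⟩`. -/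
def IsWienerIntegral (μ : Measure (Dual E)) (n : ℕ)
    (f : MultilinearMap ℂ (fun _ : Fin n => Complexify E) ℂ) (φ : Lp ℂ 2 μ) : Prop :=
  ∀ ε : ℝ, 0 < ε → ∃ (m : ℕ) (c : Fin m → ℂ) (ξ : Fin m → Complexify E),
    H.tensorNormSq 0 (f - ∑ j, c j • H.tensorPow n (ξ j)) ≤ ENNReal.ofReal ε ∧
    eLpNorm (fun x => φ x - ∑ j, c j * H.wickPow n (ξ j) x) 2 μ ≤ ENNReal.ofReal ε

/-- The Wiener-Itô expansion `φ = ∑ I_n(f_n)` in `(L²)`, with `f_n ∈ E_0^{⊗̂n}`. -/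
def IsChaosExpansion (μ : Measure (Dual E)) (φ : Lp ℂ 2 μ)
    (f : (n : ℕ) → MultilinearMap ℂ (fun _ : Fin n => Complexify E) ℂ) : Prop :=
  (∀ n, H.IsSymTensor (f n)) ∧
    ∃ g : ℕ → Lp ℂ 2 μ, (∀ n, H.IsWienerIntegral μ n (f n) (g n)) ∧ HasSum g φ

/-- `‖φ‖_{p,α}² = ∑ n! α(n) |f_n|_p²`, in terms of the chaos kernels `f_n` of `φ` -/
def cksNormSq (α : ℕ → ℝ) (p : ℕ)
    (f : (n : ℕ) → MultilinearMap ℂ (fun _ : Fin n => Complexify E) ℂ) : ℝ≥0∞ :=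
  ∑' n : ℕ, ENNReal.ofReal ((n.factorial : ℝ) * α n) * H.tensorNormSq p (f n)

/-- `[E_p]_α = {φ ∈ (L²) ; ‖φ‖_{p,α} < ∞}` -/
def cksSpace (α : ℕ → ℝ) (μ : Measure (Dual E)) (p : ℕ) : Set (Lp ℂ 2 μ) :=
  {φ | ∃ f, H.IsChaosExpansion μ φ f ∧ H.cksNormSq α p f < ∞}

/-- The space of test functions `[E]_α`, the projective limit (as a set, the intersection) of the
spaces `[E_p]_α`. -/
def testSpace (α : ℕ → ℝ) (μ : Measure (Dual E)) : Set (Lp ℂ 2 μ) :=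
  ⋂ p : ℕ, H.cksSpace α μ p

/-- The `S`-transform `Sφ(ξ) = ⟪φ, :e^{⟨·, ξ⟩}:⟫` of `φ ∈ (L²)`; the pairing is the bilinear one
of `(L²)`. -/
def sTransform (μ : Measure (Dual E)) (φ : Lp ℂ 2 μ) (ξ : Complexify E) : ℂ :=
  ∫ x, φ x * H.wickExp ξ x ∂μ

end CountablyHilbert

/-- `F` is entire along every complex line of `E_c`. -/
def EntireOnLines {E : Type*} [AddCommGroup E] [Module ℝ E] (F : Complexify E → ℂ) : Prop :=
  ∀ ξ η : Complexify E, Differentiable ℂ (fun z : ℂ => F (z • ξ + η))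

/-- The exponential generating function `G_{1/α}(r) = ∑ r^n / (n! α(n))`, on the real line. -/
def genInv (α : ℕ → ℝ) (r : ℝ) : ℝ := ∑' n : ℕ, 1 / ((n.factorial : ℝ) * α n) * r ^ n

/-- Growth condition: for all `a > 0` and `p ≥ 0` there is `K ≥ 0` with
`|F(ξ)| ≤ K G_{1/α}(a |ξ|_{-p}²)^{1/2}`. -/
def CountablyHilbert.GrowthCondition {E : Type*} [AddCommGroup E] [Module ℝ E] [UniformSpace E]
    (H : CountablyHilbert E) (α : ℕ → ℝ) (F : Complexify E → ℂ) : Prop :=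
  ∀ (a : ℝ) (p : ℕ), 0 < a → ∃ K : ℝ, 0 ≤ K ∧
    ∀ ξ : Complexify E, ‖F ξ‖ ≤ K * Real.sqrt (genInv α (a * H.cnegNorm p ξ ^ 2))

/-- Condition (A1): `α(0) = 1` and `inf α(n) > 0`. -/
def CondA1 (α : ℕ → ℝ) : Prop := α 0 = 1 ∧ ∃ c : ℝ, 0 < c ∧ ∀ n, c ≤ α n

/-- Condition (B̃1): `limsup (n! α(n) inf_{r > 0} G_{1/α}(r) / r^n)^{1/n} < ∞`. -/
def CondB1 (α : ℕ → ℝ) : Prop :=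
  limsup (fun n : ℕ => ENNReal.ofReal
    (((n.factorial : ℝ) * α n * ⨅ r : Set.Ioi (0 : ℝ), genInv α r / (r : ℝ) ^ n) ^ (1 / (n : ℝ))))
    atTop < ∞

end CKS

end

/-!
Everything is reduced to the kernels. The Gaussian Laplace transform at complex vectors
(`integral_exp_ceval`, by analytic continuation from the characteristic functional) and the
generating series of the Wick powers give `∫ ⟨:x^{⊗n}:, ξ^{⊗n}⟩ :e^{⟨x, η⟩}: dμ = ⟨ξ, η⟩^n` and the
orthogonality relation of the Wick powers. Hence `I_n(f)` has the `S`-transform `f(ξ, …, ξ)`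
(`IsWienerIntegral.sTransform_eq`), and `Sφ(ξ) = ∑ f_n(ξ, …, ξ)` (`hasSum_sTransform`).

*Growth of `Sφ`.* The dual norm `|·|_{-p}` is a Hilbert norm (`exists_negForm`), so an orthonormal
basis of the span of the real and imaginary parts of `ξ` gives `|f(ξ, …, ξ)| ≤ |f|_p |ξ|_{-p}^n`
(`norm_sq_diagonal_le`). The Cauchy-Schwarz inequality with the weights `n! α(n)` bounds `Sφ` by
`G_{1/α}(|ξ|_{-p}²)^{1/2}`, and locally uniform convergence along lines makes it entire there. A
small constant `a` is gained by passing from `p` to `p + k`, since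
`|ξ|_{-(p + k)} ≤ ρ^k |ξ|_{-p}`.

*Reconstruction.* Functions which are entire along lines and bounded on balls are closed under
directional derivatives, and these are linear in the direction and commute (`dirDerivₗ`,
`commute_dirDerivₗ`). The Taylor coefficients `f_n = (1 / n!) D ⋯ D F (0)` are therefore symmetric
multilinear forms with `F(ξ) = ∑ f_n(ξ, …, ξ)`. Cauchy's estimate on polydiscs bounds them for
`|·|_{-q}` by the infimum of `G_{1/α}(r) / r^n`; summing over a `|·|_{-p}`-orthonormal family costs
a power of the Hilbert-Schmidt norm of `E_q → E_p`, which is at most one; and (B̃1) turns the result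
into geometric decay of `n! α(n) |f_n|_p²` once `a` is small (`exists_taylorForm_decay`). The
multiple Wiener integrals of these kernels exist by density of the powers `ξ^{⊗n}`, a consequence of
polarization, together with the Itô isometry (`exists_isWienerIntegral`), and their sum converges
absolutely in `(L²)`.

*Uniqueness.* Power series in `z` for `Sφ(zξ)` determine the kernels on the diagonal, polarization
determines the kernels, and the isometry determines `φ`.
-/

namespace CKS

/-! ### Polarization -/

/-- **Polarization**: symmetrizing a multilinear form only takes its values on the diagonal. -/
theorem sum_perm_eq_sum_diagonal {V : Type*} [AddCommGroup V] [Module ℂ V] {n : ℕ}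
    (f : MultilinearMap ℂ (fun _ : Fin n => V) ℂ) (η : Fin n → V) :
    ∑ σ : Equiv.Perm (Fin n), f (fun k => η (σ k)) =
      ∑ T : Finset (Fin n), (-1 : ℂ) ^ T.card * f (fun _ => ∑ j ∈ Tᶜ, η j) := by
  classical
  have h1 : ∀ T : Finset (Fin n), (-1 : ℂ) ^ T.card * f (fun _ => ∑ j ∈ Tᶜ, η j) =
      ∑ r : Fin n → Fin n, if T ⊆ (Finset.univ.image r)ᶜ then
        (-1 : ℂ) ^ T.card * f (fun k => η (r k)) else 0 := by
    intro T
    rw [f.map_sum_finset (fun _ j => η j) (fun _ => Tᶜ), Finset.mul_sum, ← Finset.sum_filter]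
    refine Finset.sum_congr ?_ fun _ _ => rfl
    ext r
    simp only [Fintype.mem_piFinset, Finset.mem_compl, Finset.mem_filter, Finset.mem_univ,
      true_and, Finset.subset_iff, Finset.mem_image, not_exists]
    exact ⟨fun h t ht k hk => h k (hk ▸ ht), fun h k hk => h hk k rfl⟩
  -- inclusion-exclusion: only the surjective index maps survive
  have h2 : ∀ r : Fin n → Fin n, (∑ T : Finset (Fin n), if T ⊆ (Finset.univ.image r)ᶜ then
        (-1 : ℂ) ^ T.card * f (fun k => η (r k)) else 0) =
      if Function.Bijective r then f (fun k => η (r k)) else 0 := by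
    intro r
    rw [← Finset.sum_filter, ← Finset.sum_mul]
    have : Finset.univ.filter (fun T : Finset (Fin n) => T ⊆ (Finset.univ.image r)ᶜ) =
        (Finset.univ.image r)ᶜ.powerset := by ext; simp
    rw [this]
    have h3 := congrArg (Int.cast : ℤ → ℂ)
      (Finset.sum_powerset_neg_one_pow_card (x := (Finset.univ.image r)ᶜ))
    push_cast at h3
    rw [h3]
    have h4 : (Finset.univ.image r)ᶜ = ∅ ↔ Function.Bijective r := by
      rw [← Finite.surjective_iff_bijective, Finset.compl_eq_empty_iff, Finset.eq_univ_iff_forall]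
      simp [Function.Surjective]
    simp only [h4]
    split_ifs <;> simp
  rw [Finset.sum_congr rfl fun T _ => h1 T, Finset.sum_comm, Finset.sum_congr rfl fun r _ => h2 r,
    ← Finset.sum_filter]
  refine Finset.sum_bij (fun σ _ => (σ : Fin n → Fin n)) ?_ ?_ ?_ ?_
  · intro σ _; exact Finset.mem_filter.2 ⟨Finset.mem_univ _, σ.bijective⟩
  · intro σ _ τ _ h; exact DFunLike.coe_injective h
  · intro r hr
    exact ⟨Equiv.ofBijective r (Finset.mem_filter.1 hr).2, Finset.mem_univ _, rfl⟩
  · intro σ _; rfl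

/-- A symmetric multilinear form is determined by its values on the diagonal. -/
theorem eq_zero_of_diagonal {V : Type*} [AddCommGroup V] [Module ℂ V] {n : ℕ}
    (f : MultilinearMap ℂ (fun _ : Fin n => V) ℂ)
    (hs : ∀ (σ : Equiv.Perm (Fin n)) (η : Fin n → V), f (fun k => η (σ k)) = f η)
    (h0 : ∀ ξ, f (fun _ => ξ) = 0) : f = 0 := by
  ext η
  have := sum_perm_eq_sum_diagonal f η
  simp only [hs, h0, mul_zero, Finset.sum_const_zero, Finset.sum_const, nsmul_eq_mul] at this
  rcases mul_eq_zero.1 this with h | h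
  · exact absurd h (by simp [Fintype.card_ne_zero])
  · simpa using h

/-! ### Power series -/

/-- Uniqueness of the coefficients of an everywhere convergent power series. -/
theorem coeff_eq_of_hasSum {a b : ℕ → ℂ} {s : ℂ → ℂ}
    (ha : ∀ z, HasSum (fun n => a n * z ^ n) (s z))
    (hb : ∀ z, HasSum (fun n => b n * z ^ n) (s z)) : a = b := by
  have key : ∀ c : ℕ → ℂ, (∀ z, HasSum (fun n => c n * z ^ n) (s z)) →
      HasFPowerSeriesAt s (FormalMultilinearSeries.ofScalars ℂ c) 0 := by
    intro c hc
    rw [hasFPowerSeriesAt_iff]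
    refine Eventually.of_forall fun z => ?_
    simpa [FormalMultilinearSeries.coeff_ofScalars, mul_comm] using hc z
  exact FormalMultilinearSeries.ofScalars_series_injective ℂ ℂ
    ((key a ha).eq_formalMultilinearSeries (key b hb))

/-! ### Orthonormal families for a positive definite form -/

section Orthonormal

variable {V : Type*} [AddCommGroup V] [Module ℝ V] {B : LinearMap.BilinForm ℝ V}

/-- Orthonormality of a finite family for a bilinear form. -/
def IsOrtho (B : LinearMap.BilinForm ℝ V) {m : ℕ} (e : Fin m → V) : Prop :=
  ∀ j k, B (e j) (e k) = if j = k then 1 else 0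

theorem IsOrtho.apply_sum {m : ℕ} {e : Fin m → V} (he : IsOrtho B e) (c : Fin m → ℝ) (k : Fin m) :
    B (∑ j, c j • e j) (e k) = c k := by
  simp [map_sum, LinearMap.sum_apply, he _ _]

theorem IsOrtho.apply_sum_sum {m : ℕ} {e : Fin m → V} (he : IsOrtho B e) (c d : Fin m → ℝ) :
    B (∑ j, c j • e j) (∑ j, d j • e j) = ∑ j, c j * d j := by
  rw [map_sum]
  refine Finset.sum_congr rfl fun k _ => ?_
  rw [map_smul, he.apply_sum, smul_eq_mul, mul_comm]

theorem IsOrtho.eq_sum {m : ℕ} {e : Fin m → V} (he : IsOrtho B e) {v : V}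
    (hv : v ∈ Submodule.span ℝ (Set.range e)) : v = ∑ j, B v (e j) • e j := by
  obtain ⟨c, rfl⟩ := (Submodule.mem_span_range_iff_exists_fun ℝ).1 hv
  simp only [he.apply_sum]

theorem IsOrtho.apply_eq_sum (hsymm : ∀ x y, B x y = B y x) {m : ℕ} {e : Fin m → V}
    (he : IsOrtho B e) {v : V} (hv : v ∈ Submodule.span ℝ (Set.range e)) (w : V) :
    B v w = ∑ j, B v (e j) * B w (e j) := by
  conv_lhs => rw [he.eq_sum hv]
  rw [map_sum, LinearMap.sum_apply]
  refine Finset.sum_congr rfl fun j _ => ?_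
  rw [map_smul, LinearMap.smul_apply, smul_eq_mul, hsymm (e j) w]

/-- Gram-Schmidt: an orthonormal family extends to one whose span contains given vectors. -/
theorem IsOrtho.exists_extension (hsymm : ∀ x y, B x y = B y x) (hpos : ∀ x, x ≠ 0 → 0 < B x x)
    {m : ℕ} {e : Fin m → V} (he : IsOrtho B e) (l : List V) :
    ∃ (M : ℕ) (b : Fin M → V) (ι : Fin m ↪ Fin M), IsOrtho B b ∧ (∀ j, b (ι j) = e j) ∧
      ∀ v ∈ l, v ∈ Submodule.span ℝ (Set.range b) := by
  induction l with
  | nil => exact ⟨m, e, Function.Embedding.refl _, he, fun _ => rfl, by simp⟩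
  | cons v l ih =>
    obtain ⟨M, b, ι, hb, hι, hl⟩ := ih
    set w : V := v - ∑ j, B v (b j) • b j with hw
    have hwb : ∀ k, B w (b k) = 0 := by
      intro k
      rw [hw, map_sub, LinearMap.sub_apply, hb.apply_sum, sub_self]
    have hvw : v = w + ∑ j, B v (b j) • b j := by rw [hw]; abel
    by_cases h0 : w = 0
    · refine ⟨M, b, ι, hb, hι, ?_⟩
      intro x hx
      rcases List.mem_cons.1 hx with rfl | hx
      · rw [hvw, h0, zero_add]
        exact Submodule.sum_mem _ fun j _ => Submodule.smul_mem _ _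
          (Submodule.subset_span ⟨j, rfl⟩)
      · exact hl x hx
    · have hww := hpos w h0
      set s := Real.sqrt (B w w) with hs
      have hs0 : 0 < s := Real.sqrt_pos.2 hww
      have hss : s * s = B w w := Real.mul_self_sqrt hww.le
      refine ⟨M + 1, Fin.snoc (α := fun _ => V) b (s⁻¹ • w), ι.trans Fin.castSuccEmb, ?_, ?_, ?_⟩
      · intro j k
        induction j using Fin.lastCases with
        | last =>
          induction k using Fin.lastCases with
          | last =>
            simp only [Fin.snoc_last, map_smul, LinearMap.smul_apply, smul_eq_mul, ← hss]
            simp; field_simp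
          | cast k =>
            simp only [Fin.snoc_last, Fin.snoc_castSucc, map_smul, LinearMap.smul_apply, hwb,
              smul_zero]
            simp [(Fin.castSucc_lt_last k).ne']
        | cast j =>
          induction k using Fin.lastCases with
          | last =>
            simp only [Fin.snoc_last, Fin.snoc_castSucc, hsymm (b j), map_smul,
              LinearMap.smul_apply, hwb, smul_zero]
            simp [(Fin.castSucc_lt_last j).ne]
          | cast k =>
            simp only [Fin.snoc_castSucc, hb j k, Fin.castSucc_inj]
      · intro j
        simp [hι]
      · have hsub : Submodule.span ℝ (Set.range b) ≤
            Submodule.span ℝ (Set.range (Fin.snoc (α := fun _ => V) b (s⁻¹ • w) : Fin (M+1) → V)) := by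
          refine Submodule.span_mono ?_
          rintro _ ⟨j, rfl⟩
          exact ⟨j.castSucc, by simp⟩
        intro x hx
        rcases List.mem_cons.1 hx with rfl | hx
        · rw [hvw]
          refine Submodule.add_mem _ ?_ (hsub ?_)
          · refine (Submodule.smul_mem_iff _ (inv_ne_zero hs0.ne')).1
              (Submodule.subset_span ⟨Fin.last M, ?_⟩)
            rw [Fin.snoc_last]
          · exact Submodule.sum_mem _ fun j _ => Submodule.smul_mem _ _
              (Submodule.subset_span ⟨j, rfl⟩)
        · exact hsub (hl x hx)

theorem exists_isOrtho_span (hsymm : ∀ x y, B x y = B y x) (hpos : ∀ x, x ≠ 0 → 0 < B x x)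
    (l : List V) : ∃ (M : ℕ) (b : Fin M → V), IsOrtho B b ∧
      ∀ v ∈ l, v ∈ Submodule.span ℝ (Set.range b) := by
  obtain ⟨M, b, -, hb, -, h⟩ := IsOrtho.exists_extension hsymm hpos
    (e := (Fin.elim0 : Fin 0 → V)) (fun j => j.elim0) l
  exact ⟨M, b, hb, h⟩

end Orthonormal

/-! ### Cauchy-Schwarz and Bessel inequalities for multilinear forms -/

/-- Cauchy-Schwarz inequality for the Hilbert-Schmidt norm of a multilinear form. -/
theorem norm_sq_apply_sum_le {V : Type*} [AddCommGroup V] [Module ℂ V] {n m : ℕ}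
    (f : MultilinearMap ℂ (fun _ : Fin n => V) ℂ) (e : Fin m → V) (a : Fin n → Fin m → ℂ) :
    ‖f (fun k => ∑ j, a k j • e j)‖ ^ 2 ≤
      (∑ i : Fin n → Fin m, ‖f (fun k => e (i k))‖ ^ 2) * ∏ k, ∑ j, ‖a k j‖ ^ 2 := by
  classical
  rw [f.map_sum (fun k j => a k j • e j)]
  simp only [f.map_smul_univ, smul_eq_mul]
  have h1 : ∏ k, ∑ j, ‖a k j‖ ^ 2 = ∑ i : Fin n → Fin m, ‖∏ k, a k (i k)‖ ^ 2 := by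
    rw [Finset.prod_univ_sum]
    simp [Finset.prod_pow]
  rw [h1, mul_comm]
  calc _ ≤ (∑ i : Fin n → Fin m, ‖∏ k, a k (i k)‖ * ‖f (fun k => e (i k))‖) ^ 2 := by
        refine pow_le_pow_left₀ (norm_nonneg _) ((norm_sum_le _ _).trans (le_of_eq ?_)) 2
        simp
    _ ≤ _ := Finset.sum_mul_sq_le_sq_mul_sq _ _ _

/-- Bessel's inequality for the tensor powers of an orthonormal family of vectors of `ℝ^M`. -/
theorem sum_norm_sq_tensor_le {n m M : ℕ} (O : Fin m → Fin M → ℝ)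
    (hO : ∀ j k, ∑ l, O j l * O k l = if j = k then 1 else 0) (G : (Fin n → Fin M) → ℂ) :
    ∑ i' : Fin n → Fin m, ‖∑ i : Fin n → Fin M, ((∏ k, O (i' k) (i k) : ℝ) : ℂ) * G i‖ ^ 2 ≤
      ∑ i, ‖G i‖ ^ 2 := by
  classical
  let v : (Fin n → Fin m) → EuclideanSpace ℂ (Fin n → Fin M) := fun i' =>
    WithLp.toLp 2 fun i => ((∏ k, O (i' k) (i k) : ℝ) : ℂ)
  have hin : ∀ i' (x : EuclideanSpace ℂ (Fin n → Fin M)),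
      inner ℂ (v i') x = ∑ i, ((∏ k, O (i' k) (i k) : ℝ) : ℂ) * x i := by
    intro i' x
    rw [PiLp.inner_apply]
    refine Finset.sum_congr rfl fun i _ => ?_
    simp [v, mul_comm]
  have hv : Orthonormal ℂ v := by
    rw [orthonormal_iff_ite]
    intro i' j'
    rw [hin]
    have : ∀ i, ((∏ k, O (i' k) (i k) : ℝ) : ℂ) * (v j') i =
        ((∏ k, O (i' k) (i k) * O (j' k) (i k) : ℝ) : ℂ) := by
      intro i; simp [v, Finset.prod_mul_distrib]
    simp only [this]
    rw [← Complex.ofReal_sum]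
    have h2 := Finset.prod_univ_sum (fun _ : Fin n => (Finset.univ : Finset (Fin M)))
      (fun k l => O (i' k) l * O (j' k) l)
    rw [Fintype.piFinset_univ] at h2
    rw [← h2]
    simp only [hO]
    by_cases h : i' = j'
    · simp [h]
    · obtain ⟨k, hk⟩ := Function.ne_iff.1 h
      rw [if_neg h, Finset.prod_eq_zero (Finset.mem_univ k) (if_neg hk)]
      simp
  have := hv.sum_inner_products_le (s := Finset.univ) (WithLp.toLp 2 G)
  simp only [hin, EuclideanSpace.norm_sq_eq] at this
  exact this

universe u

/-! ### The dual norms are Hilbert norms -/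

/-- A vector space with a positive definite form is a dense subspace of a Hilbert space. -/
theorem exists_hilbert_completion {V : Type u} [AddCommGroup V] [Module ℝ V]
    (B : LinearMap.BilinForm ℝ V) (hsymm : ∀ x y, B x y = B y x)
    (hpos : ∀ x, x ≠ 0 → 0 < B x x) :
    ∃ (K : Type u) (_ : NormedAddCommGroup K) (_ : InnerProductSpace ℝ K) (_ : CompleteSpace K)
      (ι : V →ₗ[ℝ] K), DenseRange ι ∧ ∀ x y, inner ℝ (ι x) (ι y) = B x y := by
  let core : InnerProductSpace.Core ℝ V :=
    { inner := fun x y => B x y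
      conj_inner_symm := fun x y => by simpa using hsymm y x
      re_inner_nonneg := fun x => by
        by_cases h : x = 0
        · simp [h]
        · simpa using (hpos x h).le
      add_left := fun x y z => by simp
      smul_left := fun x y r => by simp
      definite := fun x hx => by
        by_contra h
        exact (hpos x h).ne' hx }
  let _ : NormedAddCommGroup V := core.toNormedAddCommGroup
  let _ : InnerProductSpace ℝ V := InnerProductSpace.ofCore core.toCore
  refine ⟨UniformSpace.Completion V, inferInstance, inferInstance, inferInstance,
    (UniformSpace.Completion.toComplL (𝕜 := ℝ) (E := V)).toLinearMap, ?_, ?_⟩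
  · exact UniformSpace.Completion.denseRange_coe
  · intro x y
    exact UniformSpace.Completion.inner_coe x y

theorem Complexify.sum_smul_ofReal {V : Type*} [AddCommGroup V] [Module ℝ V] {M : ℕ}
    (c d : Fin M → ℝ) (b : Fin M → V) :
    ∑ j, (⟨c j, d j⟩ : ℂ) • Complexify.ofReal (b j) =
      Complexify.mk (∑ j, c j • b j) (∑ j, d j • b j) := by
  have reSum : ∀ (g : Fin M → Complexify V), (∑ j, g j).re = ∑ j, (g j).re := fun g =>
    Prod.fst_sum
  have imSum : ∀ (g : Fin M → Complexify V), (∑ j, g j).im = ∑ j, (g j).im := fun g =>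
    Prod.snd_sum
  ext
  · rw [reSum]; simp [Complexify.ofReal]
  · rw [imSum]; simp [Complexify.ofReal]

namespace CountablyHilbert

variable {E : Type*} [AddCommGroup E] [Module ℝ E] [UniformSpace E] (H : CountablyHilbert E)

theorem ip_self_nonneg (p : ℕ) (ξ : E) : 0 ≤ H.ip p ξ ξ := by
  by_cases h : ξ = 0
  · simp [h]
  · exact (H.pos p ξ h).le

theorem norm_sq (p : ℕ) (ξ : E) : H.norm p ξ ^ 2 = H.ip p ξ ξ :=
  Real.sq_sqrt (H.ip_self_nonneg p ξ)

theorem norm_nonneg (p : ℕ) (ξ : E) : 0 ≤ H.norm p ξ := Real.sqrt_nonneg _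

theorem norm_pos (p : ℕ) {ξ : E} (h : ξ ≠ 0) : 0 < H.norm p ξ := Real.sqrt_pos.2 (H.pos p ξ h)

theorem norm_smul (p : ℕ) (c : ℝ) (ξ : E) : H.norm p (c • ξ) = |c| * H.norm p ξ := by
  rw [norm, norm, ← Real.sqrt_sq_eq_abs, ← Real.sqrt_mul (sq_nonneg c)]
  simp; ring_nf

theorem abs_ip_le (p : ℕ) (ξ η : E) : |H.ip p ξ η| ≤ H.norm p ξ * H.norm p η := by
  obtain ⟨K, _, _, _, ι, -, hι⟩ := exists_hilbert_completion (H.ip p) (H.symm p) (H.pos p)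
  have := abs_real_inner_le_norm (ι ξ) (ι η)
  rwa [hι, norm_eq_sqrt_real_inner (ι ξ), norm_eq_sqrt_real_inner (ι η), hι, hι] at this

variable (h0 : ∀ p ξ, H.norm 0 ξ ≤ H.norm p ξ)
include h0

omit h0 in
theorem negNorm_bddAbove {p : ℕ} (hp : ∀ ξ, H.norm 0 ξ ≤ H.norm p ξ) (ξ : E) :
    BddAbove {t : ℝ | ∃ η : E, H.norm p η ≤ 1 ∧ t = |H.ip 0 ξ η|} := by
  refine ⟨H.norm 0 ξ, ?_⟩
  rintro _ ⟨η, hη, rfl⟩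
  refine (H.abs_ip_le 0 ξ η).trans ?_
  exact mul_le_of_le_one_right (H.norm_nonneg 0 ξ) ((hp η).trans hη)

omit h0 in
theorem negNorm_nonneg (p : ℕ) (ξ : E) : 0 ≤ H.negNorm p ξ := by
  refine Real.sSup_nonneg ?_
  rintro _ ⟨η, -, rfl⟩
  exact abs_nonneg _

omit h0 in
theorem abs_ip_zero_le {p : ℕ} (hp : ∀ ξ, H.norm 0 ξ ≤ H.norm p ξ) (ξ η : E) :
    |H.ip 0 ξ η| ≤ H.negNorm p ξ * H.norm p η := by
  by_cases h : η = 0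
  · simpa [h] using mul_nonneg (H.negNorm_nonneg p ξ) (H.norm_nonneg p 0)
  · have hη := H.norm_pos p h
    have h1 : |H.ip 0 ξ ((H.norm p η)⁻¹ • η)| ≤ H.negNorm p ξ := by
      refine le_csSup (H.negNorm_bddAbove hp ξ) ⟨_, ?_, rfl⟩
      rw [norm_smul, abs_of_pos (inv_pos.2 hη), inv_mul_cancel₀ hη.ne']
    rw [map_smul, smul_eq_mul, abs_mul, abs_of_pos (inv_pos.2 hη), inv_mul_eq_div,
      div_le_iff₀ hη] at h1
    exact h1

omit h0 in
theorem negNorm_le (p : ℕ) (ξ : E) {C : ℝ} (hC : ∀ η, H.norm p η ≤ 1 → |H.ip 0 ξ η| ≤ C) :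
    H.negNorm p ξ ≤ C := by
  refine csSup_le ⟨_, 0, ?_, rfl⟩ ?_
  · simp [norm]
  · rintro _ ⟨η, hη, rfl⟩
    exact hC η hη

omit h0 in
theorem negNorm_zero (ξ : E) : H.negNorm 0 ξ = H.norm 0 ξ := by
  refine le_antisymm (H.negNorm_le 0 ξ fun η hη => ?_) ?_
  · exact (H.abs_ip_le 0 ξ η).trans (mul_le_of_le_one_right (H.norm_nonneg 0 ξ) hη)
  · by_cases h : ξ = 0
    · simpa [h, norm] using H.negNorm_nonneg 0 0
    · have := H.abs_ip_zero_le (fun _ => le_rfl) ξ ξ (p := 0)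
      rw [← H.norm_sq, abs_of_nonneg (sq_nonneg _), sq] at this
      exact le_of_mul_le_mul_right this (H.norm_pos 0 h)

/-- The dual norm `|·|_{-p}` comes from an inner product: with `J : E_p → E_0` the canonical map
between the completions, `|ξ|_{-p}` is the norm of `J* ξ`. -/
theorem exists_negForm (p : ℕ) : ∃ B : LinearMap.BilinForm ℝ E,
    (∀ x y, B x y = B y x) ∧ ∀ x, B x x = H.negNorm p x ^ 2 := by
  obtain ⟨K, _, _, _, ι, hd, hι⟩ := exists_hilbert_completion (H.ip p) (H.symm p) (H.pos p)
  obtain ⟨L, _, _, _, κ, -, hκ⟩ := exists_hilbert_completion (H.ip 0) (H.symm 0) (H.pos 0)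
  have nι : ∀ x, ‖ι x‖ = H.norm p x := fun x => by
    rw [norm_eq_sqrt_real_inner, hι]; rfl
  have nκ : ∀ x, ‖κ x‖ = H.norm 0 x := fun x => by
    rw [norm_eq_sqrt_real_inner, hκ]; rfl
  let J : K →L[ℝ] L := κ.extendOfNorm ι
  have hJ : ∀ x, J (ι x) = κ x := fun x =>
    LinearMap.extendOfNorm_eq hd ⟨1, fun x => by rw [nι, nκ, one_mul]; exact h0 p x⟩ x
  let R : E →ₗ[ℝ] K := J.adjoint.toLinearMap ∘ₗ κ
  have hR : ∀ x y, inner ℝ (R x) (ι y) = H.ip 0 x y := by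
    intro x y
    change inner ℝ (J.adjoint (κ x)) (ι y) = _
    rw [ContinuousLinearMap.adjoint_inner_left, hJ, hκ]
  have hle : ∀ x, ‖R x‖ ≤ H.negNorm p x := by
    intro x
    have h1 : ∀ k : K, |inner ℝ (R x) k| ≤ H.negNorm p x * ‖k‖ := by
      intro k
      refine hd.induction_on (p := fun k => |inner ℝ (R x) k| ≤ H.negNorm p x * ‖k‖) k
        (isClosed_le (by fun_prop) (by fun_prop)) fun y => ?_
      rw [hR, nι]
      exact H.abs_ip_zero_le (h0 p) x y
    have h2 := h1 (R x)
    rw [real_inner_self_eq_norm_sq, abs_of_nonneg (sq_nonneg _), sq] at h2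
    rcases (_root_.norm_nonneg (R x)).eq_or_lt with h | h
    · rw [← h]; exact H.negNorm_nonneg p x
    · exact le_of_mul_le_mul_right h2 h
  refine ⟨(innerₗ K).compl₁₂ R R, fun x y => real_inner_comm _ _, fun x => ?_⟩
  change inner ℝ (R x) (R x) = _
  rw [real_inner_self_eq_norm_sq]
  congr 1
  refine le_antisymm (hle x) (H.negNorm_le p x fun η hη => ?_)
  rw [← hR]
  refine (abs_real_inner_le_norm _ _).trans (mul_le_of_le_one_right (_root_.norm_nonneg _) ?_)
  rwa [nι]

theorem negNorm_pos (p : ℕ) {ξ : E} (hξ : ξ ≠ 0) : 0 < H.negNorm p ξ := by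
  refine (H.negNorm_nonneg p ξ).lt_of_ne fun h => ?_
  have := H.abs_ip_zero_le (h0 p) ξ ξ
  rw [← h, zero_mul] at this
  exact (H.pos 0 ξ hξ).ne' (abs_nonpos_iff.1 this)

omit h0 in
theorem isNegOrthonormal_iff {p : ℕ} {B : LinearMap.BilinForm ℝ E} (hs : ∀ x y, B x y = B y x)
    (hB : ∀ x, B x x = H.negNorm p x ^ 2) {m : ℕ} (e : Fin m → E) :
    H.IsNegOrthonormal p e ↔ IsOrtho B e := by
  constructor
  · intro h
    have h1 : ∀ j, B (e j) (e j) = 1 := by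
      intro j
      have := h (Pi.single j 1)
      rw [← hB] at this
      simpa [Pi.single_apply, ite_smul] using this
    intro j k
    by_cases hjk : j = k
    · rw [hjk, h1, if_pos rfl]
    · have h2 := h (Pi.single j 1 + Pi.single k 1)
      rw [← hB] at h2
      have h3 : ∑ i, (Pi.single j 1 + Pi.single k 1 : Fin m → ℝ) i • e i = e j + e k := by
        simp [Pi.single_apply, ite_smul, add_smul, Finset.sum_add_distrib]
      have h4 : ∑ i, (Pi.single j 1 + Pi.single k 1 : Fin m → ℝ) i ^ 2 = 2 := by
        simp [Pi.single_apply, add_sq, Finset.sum_add_distrib, Ne.symm hjk]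
        norm_num
      rw [h3, h4] at h2
      simp only [map_add, LinearMap.add_apply, h1, hs (e k) (e j)] at h2
      rw [if_neg hjk]
      linarith
  · intro h c
    rw [← hB, h.apply_sum_sum]
    simp [sq]

omit h0 in
theorem isNegOrthonormal_zero_iff {m : ℕ} (e : Fin m → E) :
    H.IsNegOrthonormal 0 e ↔ IsOrtho (H.ip 0) e :=
  H.isNegOrthonormal_iff (H.symm 0) (fun x => by rw [negNorm_zero, norm_sq]) e

/-! ### The norms on the complexification -/

omit h0 in
theorem cnegNorm_sq (p : ℕ) (ξ : Complexify E) :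
    H.cnegNorm p ξ ^ 2 = H.negNorm p ξ.re ^ 2 + H.negNorm p ξ.im ^ 2 :=
  Real.sq_sqrt (by positivity)

omit h0 in
theorem cnegNorm_nonneg (p : ℕ) (ξ : Complexify E) : 0 ≤ H.cnegNorm p ξ := Real.sqrt_nonneg _

omit h0 in
theorem negNorm_apply_zero (p : ℕ) : H.negNorm p 0 = 0 :=
  le_antisymm (H.negNorm_le p 0 (by simp)) (H.negNorm_nonneg p 0)

omit h0 in
theorem cnegNorm_ofReal (p : ℕ) (u : E) : H.cnegNorm p (Complexify.ofReal u) = H.negNorm p u := by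
  rw [cnegNorm, Complexify.ofReal, Complexify.mk_re, Complexify.mk_im, negNorm_apply_zero]
  simp [H.negNorm_nonneg p u]

/-- The norm `|·|_{-p}` of `E_c` as a seminorm. -/
noncomputable def cnegSeminorm (p : ℕ) : Seminorm ℂ (Complexify E) :=
  Seminorm.ofSMulLE (H.cnegNorm p)
    ((H.cnegNorm_ofReal p 0).trans (H.negNorm_apply_zero p))
    (fun ξ η => by
      obtain ⟨B, hs, hB⟩ := H.exists_negForm h0 p
      have tri : ∀ u v : E, H.negNorm p (u + v) ≤ H.negNorm p u + H.negNorm p v := by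
        intro u v
        refine H.negNorm_le p _ fun ζ hζ => ?_
        have h1 := (H.abs_ip_zero_le (h0 p) u ζ).trans
          (mul_le_of_le_one_right (H.negNorm_nonneg p u) hζ)
        have h2 := (H.abs_ip_zero_le (h0 p) v ζ).trans
          (mul_le_of_le_one_right (H.negNorm_nonneg p v) hζ)
        rw [map_add, LinearMap.add_apply]
        exact (abs_add_le _ _).trans (add_le_add h1 h2)
      have h1 := tri ξ.re η.re
      have h2 := tri ξ.im η.im
      have n1 := H.negNorm_nonneg p (ξ.re + η.re)
      have n2 := H.negNorm_nonneg p (ξ.im + η.im)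
      refine abs_le_of_sq_le_sq' ?_ (add_nonneg (H.cnegNorm_nonneg p ξ) (H.cnegNorm_nonneg p η)) |>.2
      have e1 := H.cnegNorm_sq p ξ
      have e2 := H.cnegNorm_sq p η
      rw [cnegNorm_sq, Complexify.add_re, Complexify.add_im, add_sq, e1, e2]
      set a := H.negNorm p ξ.re
      set b := H.negNorm p ξ.im
      set c := H.negNorm p η.re
      set d := H.negNorm p η.im
      have h3 : a * c + b * d ≤ H.cnegNorm p ξ * H.cnegNorm p η := by
        refine abs_le_of_sq_le_sq' ?_
          (mul_nonneg (H.cnegNorm_nonneg p ξ) (H.cnegNorm_nonneg p η)) |>.2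
        rw [mul_pow, e1, e2]
        nlinarith [sq_nonneg (a * d - b * c)]
      nlinarith [pow_le_pow_left₀ n1 h1 2, pow_le_pow_left₀ n2 h2 2])
    (fun z ξ => by
      obtain ⟨B, hs, hB⟩ := H.exists_negForm h0 p
      refine abs_le_of_sq_le_sq' (le_of_eq ?_)
        (mul_nonneg (_root_.norm_nonneg z) (H.cnegNorm_nonneg p ξ)) |>.2
      rw [mul_pow, cnegNorm_sq, cnegNorm_sq, ← hB, ← hB, ← hB, ← hB, Complexify.smul_re,
        Complexify.smul_im, ← Complex.normSq_eq_norm_sq, Complex.normSq_apply]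
      simp only [map_sub, map_add, map_smul, LinearMap.sub_apply, LinearMap.add_apply,
        LinearMap.smul_apply, smul_eq_mul, hs ξ.im ξ.re]
      ring)

@[simp] theorem cnegSeminorm_apply (p : ℕ) (ξ : Complexify E) :
    H.cnegSeminorm h0 p ξ = H.cnegNorm p ξ := rfl

theorem cnegNorm_succ_le {ρ : ℝ} (hρ : 0 ≤ ρ) (p : ℕ)
    (ha : ∀ ξ : E, H.norm p ξ ≤ ρ * H.norm (p + 1) ξ) (ξ : Complexify E) :
    H.cnegNorm (p + 1) ξ ≤ ρ * H.cnegNorm p ξ := by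
  have key : ∀ u : E, H.negNorm (p + 1) u ≤ ρ * H.negNorm p u := by
    intro u
    refine H.negNorm_le _ u fun η hη => (H.abs_ip_zero_le (h0 p) u η).trans ?_
    rw [mul_comm]
    refine mul_le_mul_of_nonneg_right ((ha η).trans ?_) (H.negNorm_nonneg p u)
    exact mul_le_of_le_one_right hρ hη
  refine abs_le_of_sq_le_sq' ?_ (mul_nonneg hρ (H.cnegNorm_nonneg p ξ)) |>.2
  rw [mul_pow, cnegNorm_sq, cnegNorm_sq, mul_add, ← mul_pow, ← mul_pow]
  exact add_le_add (pow_le_pow_left₀ (H.negNorm_nonneg _ _) (key _) 2)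
    (pow_le_pow_left₀ (H.negNorm_nonneg _ _) (key _) 2)

theorem cnegNorm_add_le_pow {ρ : ℝ} (hρ : 0 ≤ ρ)
    (ha : ∀ (p : ℕ) (ξ : E), H.norm p ξ ≤ ρ * H.norm (p + 1) ξ) (p k : ℕ) (ξ : Complexify E) :
    H.cnegNorm (p + k) ξ ≤ ρ ^ k * H.cnegNorm p ξ := by
  induction k with
  | zero => simp
  | succ k ih =>
    refine (H.cnegNorm_succ_le h0 hρ (p + k) (ha _) ξ).trans ?_
    rw [pow_succ', mul_assoc]
    exact mul_le_mul_of_nonneg_left ih hρ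

/-- The canonical map `E_{-p} → E_{-q}` has the same Hilbert-Schmidt norm as its adjoint
`E_q → E_p`. -/
theorem sum_negNorm_sq_le_one {p q : ℕ} (hq : H.hsNormSq q p < 1) {m : ℕ} {e : Fin m → E}
    (he : H.IsNegOrthonormal p e) : ∑ j, H.negNorm q (e j) ^ 2 ≤ 1 := by
  obtain ⟨B, hs, hB⟩ := H.exists_negForm h0 p
  have heB := (H.isNegOrthonormal_iff hs hB e).1 he
  have hne : ∀ j, e j ≠ 0 := by
    intro j h
    have := heB j j
    simp [h] at this
  have key : ∀ θ : ℝ, 0 ≤ θ → θ < 1 → θ ^ 2 * ∑ j, H.negNorm q (e j) ^ 2 ≤ 1 := by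
    intro θ hθ0 hθ
    have h1 : ∀ j, ∃ η : E, H.norm q η ≤ 1 ∧ θ * H.negNorm q (e j) ≤ |H.ip 0 (e j) η| := by
      intro j
      by_contra! hcon
      have h2 : H.negNorm q (e j) ≤ θ * H.negNorm q (e j) :=
        H.negNorm_le q (e j) fun η hη => (hcon η hη).le
      nlinarith [H.negNorm_pos h0 q (hne j)]
    choose η hη1 hη2 using h1
    obtain ⟨M, b, hb, hspan⟩ := exists_isOrtho_span (H.symm q) (H.pos q) (List.ofFn η)
    -- the adjoint map sends `e j` to a functional with coordinates `⟨e j, b l⟩_0`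
    have h3 : ∀ j, (θ * H.negNorm q (e j)) ^ 2 ≤ ∑ l, H.ip 0 (e j) (b l) ^ 2 := by
      intro j
      have hmem := hspan (η j) (List.mem_ofFn.2 ⟨j, rfl⟩)
      have h4 : H.ip 0 (e j) (η j) = ∑ l, H.ip q (η j) (b l) * H.ip 0 (e j) (b l) := by
        conv_lhs => rw [hb.eq_sum hmem]
        simp
      have h5 : ∑ l, H.ip q (η j) (b l) ^ 2 ≤ 1 := by
        have := hb.apply_eq_sum (H.symm q) hmem (η j)
        rw [← H.norm_sq] at this
        simp only [← sq] at this
        rw [← this]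
        exact pow_le_one₀ (H.norm_nonneg q _) (hη1 j)
      calc (θ * H.negNorm q (e j)) ^ 2 ≤ |H.ip 0 (e j) (η j)| ^ 2 :=
            pow_le_pow_left₀ (mul_nonneg hθ0 (H.negNorm_nonneg q _)) (hη2 j) 2
        _ = (∑ l, H.ip q (η j) (b l) * H.ip 0 (e j) (b l)) ^ 2 := by rw [sq_abs, h4]
        _ ≤ (∑ l, H.ip q (η j) (b l) ^ 2) * ∑ l, H.ip 0 (e j) (b l) ^ 2 :=
            Finset.sum_mul_sq_le_sq_mul_sq _ _ _
        _ ≤ _ := mul_le_of_le_one_left (Finset.sum_nonneg fun _ _ => sq_nonneg _) h5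
    have h6 : ∀ l, ∑ j, H.ip 0 (e j) (b l) ^ 2 ≤ H.norm p (b l) ^ 2 := by
      intro l
      set S := ∑ j, H.ip 0 (e j) (b l) ^ 2 with hS
      have hS0 : 0 ≤ S := Finset.sum_nonneg fun _ _ => sq_nonneg _
      have h7 := H.abs_ip_zero_le (h0 p) (∑ j, H.ip 0 (e j) (b l) • e j) (b l)
      have h8 : H.ip 0 (∑ j, H.ip 0 (e j) (b l) • e j) (b l) = S := by
        simp [map_sum, LinearMap.sum_apply, hS, sq]
      have h9 := he fun j => H.ip 0 (e j) (b l)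
      rw [← hS] at h9
      rw [h8, abs_of_nonneg hS0] at h7
      have h10 := pow_le_pow_left₀ hS0 h7 2
      rw [mul_pow, h9] at h10
      rcases hS0.eq_or_lt with h | h
      · rw [← h]; exact sq_nonneg _
      · rw [sq] at h10
        exact le_of_mul_le_mul_left h10 h
    have h11 : ∑ l, H.norm p (b l) ^ 2 ≤ 1 := by
      have : ∑ l, ENNReal.ofReal (H.norm p (b l) ^ 2) ≤ H.hsNormSq q p :=
        le_iSup_of_le M (le_iSup_of_le b (le_iSup_of_le hb le_rfl))
      rw [← ENNReal.ofReal_sum_of_nonneg fun _ _ => sq_nonneg _] at this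
      have := (this.trans_lt hq).le
      rwa [ENNReal.ofReal_le_one] at this
    calc θ ^ 2 * ∑ j, H.negNorm q (e j) ^ 2 = ∑ j, (θ * H.negNorm q (e j)) ^ 2 := by
          rw [Finset.mul_sum]; simp only [mul_pow]
      _ ≤ ∑ j, ∑ l, H.ip 0 (e j) (b l) ^ 2 := Finset.sum_le_sum fun j _ => h3 j
      _ = ∑ l, ∑ j, H.ip 0 (e j) (b l) ^ 2 := Finset.sum_comm
      _ ≤ ∑ l, H.norm p (b l) ^ 2 := Finset.sum_le_sum fun l _ => h6 l
      _ ≤ 1 := h11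
  have ht : Tendsto (fun θ : ℝ => θ ^ 2 * ∑ j, H.negNorm q (e j) ^ 2) (𝓝[<] 1)
      (𝓝 (∑ j, H.negNorm q (e j) ^ 2)) :=
    (Continuous.tendsto' (by fun_prop) _ _ (by simp)).mono_left nhdsWithin_le_nhds
  refine le_of_tendsto ht ?_
  filter_upwards [Ioo_mem_nhdsLT (show (0 : ℝ) < 1 by norm_num)] with θ hθ
  exact key θ hθ.1.le hθ.2

/-! ### Hilbert-Schmidt norms of multilinear forms -/

omit h0 in
theorem sum_le_tensorNormSq {p n m : ℕ}
    (f : MultilinearMap ℂ (fun _ : Fin n => Complexify E) ℂ) {e : Fin m → E}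
    (he : H.IsNegOrthonormal p e) :
    ENNReal.ofReal (∑ i : Fin n → Fin m, ‖f (fun k => Complexify.ofReal (e (i k)))‖ ^ 2) ≤
      H.tensorNormSq p f := by
  rw [ENNReal.ofReal_sum_of_nonneg fun _ _ => sq_nonneg _]
  exact le_iSup_of_le m (le_iSup_of_le e (le_iSup_of_le he le_rfl))

omit h0 in
theorem tensorNormSq_le {p n : ℕ}
    (f : MultilinearMap ℂ (fun _ : Fin n => Complexify E) ℂ) {C : ℝ≥0∞}
    (h : ∀ (m : ℕ) (e : Fin m → E), H.IsNegOrthonormal p e →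
      ENNReal.ofReal (∑ i : Fin n → Fin m, ‖f (fun k => Complexify.ofReal (e (i k)))‖ ^ 2) ≤ C) :
    H.tensorNormSq p f ≤ C := by
  refine iSup_le fun m => iSup_le fun e => iSup_le fun he => ?_
  rw [← ENNReal.ofReal_sum_of_nonneg fun _ _ => sq_nonneg _]
  exact h m e he

omit h0 in
theorem tensorNormSq_sub_le {p n : ℕ}
    (f g : MultilinearMap ℂ (fun _ : Fin n => Complexify E) ℂ) :
    H.tensorNormSq p (f - g) ≤ 2 * (H.tensorNormSq p f + H.tensorNormSq p g) := by
  refine H.tensorNormSq_le _ fun m e he => ?_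
  have h1 := add_le_add (H.sum_le_tensorNormSq f he) (H.sum_le_tensorNormSq g he)
  rw [← ENNReal.ofReal_add (Finset.sum_nonneg fun _ _ => sq_nonneg _)
    (Finset.sum_nonneg fun _ _ => sq_nonneg _)] at h1
  refine le_trans ?_ (mul_le_mul_right h1 2)
  rw [← ENNReal.ofReal_ofNat 2, ← ENNReal.ofReal_mul (by norm_num)]
  refine ENNReal.ofReal_le_ofReal ?_
  rw [← Finset.sum_add_distrib, Finset.mul_sum]
  refine Finset.sum_le_sum fun i _ => ?_
  rw [_root_.sub_apply]
  have := norm_sub_le (f fun k => Complexify.ofReal (e (i k)))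
    (g fun k => Complexify.ofReal (e (i k)))
  have h3 := pow_le_pow_left₀ (_root_.norm_nonneg _) this 2
  nlinarith [sq_nonneg (‖f fun k => Complexify.ofReal (e (i k))‖ -
    ‖g fun k => Complexify.ofReal (e (i k))‖)]

/-- `|f(ξ, …, ξ)| ≤ |f|_p |ξ|_{-p}^n`. -/
theorem norm_sq_diagonal_le {p n : ℕ}
    (f : MultilinearMap ℂ (fun _ : Fin n => Complexify E) ℂ) (hf : H.tensorNormSq p f ≠ ∞)
    (ξ : Complexify E) :
    ‖f (fun _ => ξ)‖ ^ 2 ≤ (H.tensorNormSq p f).toReal * (H.cnegNorm p ξ ^ 2) ^ n := by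
  obtain ⟨B, hs, hB⟩ := H.exists_negForm h0 p
  have hpos : ∀ x, x ≠ 0 → 0 < B x x := fun x hx => by
    rw [hB]; exact pow_pos (H.negNorm_pos h0 p hx) 2
  obtain ⟨M, b, hb, hspan⟩ := exists_isOrtho_span hs hpos [ξ.re, ξ.im]
  have hre := hspan ξ.re (by simp)
  have him := hspan ξ.im (by simp)
  have hξ : ξ = ∑ j, (⟨B ξ.re (b j), B ξ.im (b j)⟩ : ℂ) • Complexify.ofReal (b j) := by
    rw [Complexify.sum_smul_ofReal, ← hb.eq_sum hre, ← hb.eq_sum him]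
    rfl
  have h1 := norm_sq_apply_sum_le f (fun j => Complexify.ofReal (b j))
    (fun _ j => (⟨B ξ.re (b j), B ξ.im (b j)⟩ : ℂ))
  rw [← hξ] at h1
  refine h1.trans ?_
  have h2 : ∑ j, ‖(⟨B ξ.re (b j), B ξ.im (b j)⟩ : ℂ)‖ ^ 2 = H.cnegNorm p ξ ^ 2 := by
    rw [cnegNorm_sq, ← hB, ← hB, hb.apply_eq_sum hs hre, hb.apply_eq_sum hs him,
      ← Finset.sum_add_distrib]
    refine Finset.sum_congr rfl fun j _ => ?_
    rw [← Complex.normSq_eq_norm_sq, Complex.normSq_apply]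
  rw [h2, Finset.prod_const, Finset.card_univ, Fintype.card_fin]
  refine mul_le_mul_of_nonneg_right ?_ (by positivity)
  rw [← ENNReal.ofReal_le_iff_le_toReal hf]
  exact H.sum_le_tensorNormSq f ((H.isNegOrthonormal_iff hs hB b).2 hb)

end CountablyHilbert

/-! ### Gaussian integrals -/

namespace CountablyHilbert

variable {E : Type*} [AddCommGroup E] [Module ℝ E] [UniformSpace E] (H : CountablyHilbert E)

theorem measurable_eval (ξ : E) : Measurable fun x : Dual E => x.eval ξ := 
  measurable_iff_comap_le.2 (le_iSup (fun ξ : E =>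
    MeasurableSpace.comap (fun x : Dual E => x.eval ξ) (borel ℝ)) ξ)

theorem eval_add (x : Dual E) (ξ η : E) : x.eval (ξ + η) = x.eval ξ + x.eval η :=
  map_add (show E →L[ℝ] ℝ from x) ξ η

theorem eval_smul (x : Dual E) (c : ℝ) (ξ : E) : x.eval (c • ξ) = c * x.eval ξ :=
  map_smul (show E →L[ℝ] ℝ from x) c ξ

theorem ceval_add (x : Dual E) (ξ η : Complexify E) : x.ceval (ξ + η) = x.ceval ξ + x.ceval η := by
  apply Complex.ext <;> simp [Dual.ceval, eval_add]

theorem ceval_smul (x : Dual E) (z : ℂ) (ξ : Complexify E) : x.ceval (z • ξ) = z * x.ceval ξ := by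
  apply Complex.ext <;> simp [Dual.ceval, eval_add, eval_smul, sub_eq_add_neg, ← neg_smul]

theorem ceval_eq (x : Dual E) (ξ : Complexify E) :
    x.ceval ξ = x.eval ξ.re + Complex.I * x.eval ξ.im := by
  apply Complex.ext <;> simp [Dual.ceval]

theorem measurable_ceval (ξ : Complexify E) : Measurable fun x : Dual E => x.ceval ξ := by
  simp only [ceval_eq]
  have h1 := measurable_eval ξ.re
  have h2 := measurable_eval ξ.im
  fun_prop

variable {H} {μ : Measure (Dual E)} (hμ : H.IsStandardGaussian μ)
include hμ

theorem map_eval (ξ : E) : μ.map (fun x => x.eval ξ) =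
    ProbabilityTheory.gaussianReal 0 (H.ip 0 ξ ξ).toNNReal := by
  have := hμ.1
  have hm := measurable_eval ξ
  have := Measure.isProbabilityMeasure_map (μ := μ) hm.aemeasurable
  refine Measure.ext_of_charFun ?_
  ext t
  rw [ProbabilityTheory.charFun_gaussianReal, charFun_apply_real,
    integral_map hm.aemeasurable (by fun_prop)]
  have h := hμ.2 (t • ξ)
  rw [← Complex.ofReal_pow, H.norm_sq] at h
  simp only [eval_smul, map_smul, LinearMap.smul_apply, smul_eq_mul] at h
  convert h using 2
  · ext x; push_cast; ring_nf
  · simp [Real.coe_toNNReal _ (H.ip_self_nonneg 0 ξ)]; ring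

theorem integrable_exp_eval (ξ : E) : Integrable (fun x => Real.exp (x.eval ξ)) μ := by
  have h := ProbabilityTheory.integrable_exp_mul_gaussianReal (μ := 0)
    (v := (H.ip 0 ξ ξ).toNNReal) 1
  rw [← map_eval hμ ξ] at h
  simpa [Function.comp_def] using h.comp_measurable (measurable_eval ξ)

theorem integrable_exp_abs_add (ξ η : E) :
    Integrable (fun x => Real.exp (|x.eval ξ| + |x.eval η|)) μ := by
  have h := (((integrable_exp_eval hμ (ξ + η)).add (integrable_exp_eval hμ (ξ + (-1 : ℝ) • η))).add
    (integrable_exp_eval hμ ((-1 : ℝ) • ξ + η))).add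
    (integrable_exp_eval hμ ((-1 : ℝ) • ξ + (-1 : ℝ) • η))
  refine h.mono' ?_ (Eventually.of_forall fun x => ?_)
  · have h1 := measurable_eval ξ
    have h2 := measurable_eval η
    exact Measurable.aestronglyMeasurable (by fun_prop)
  · simp only [Real.norm_eq_abs, Real.abs_exp, Pi.add_apply, eval_add, eval_smul]
    have p := Real.exp_pos
    rcases abs_cases (x.eval ξ) with ⟨h1, -⟩ | ⟨h1, -⟩ <;>
    rcases abs_cases (x.eval η) with ⟨h2, -⟩ | ⟨h2, -⟩ <;> rw [h1, h2] <;>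
    simp only [neg_mul, one_mul] <;>
    linarith [p (x.eval ξ + x.eval η), p (x.eval ξ + -x.eval η), p (-x.eval ξ + x.eval η),
      p (-x.eval ξ + -x.eval η)]

/-- The Laplace transform of the Gaussian measure at complex vectors, by analytic continuation in
`z` from the imaginary axis of `z ↦ ∫ exp (z ⟨x, u⟩ + i ⟨x, v⟩) dμ`. -/
theorem integral_exp_ceval (ξ : Complexify E) :
    ∫ x, Complex.exp (x.ceval ξ) ∂μ = Complex.exp (H.cpair ξ ξ / 2) := by
  have := hμ.1
  set u := ξ.re with hu
  set v := ξ.im with hv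
  have mu := measurable_eval u
  have mv := measurable_eval v
  let L : ℂ → ℂ := fun z => ∫ x, Complex.exp (z * x.eval u + Complex.I * x.eval v) ∂μ
  let R : ℂ → ℂ := fun z => Complex.exp
    ((z ^ 2 * H.ip 0 u u + 2 * z * Complex.I * H.ip 0 u v - H.ip 0 v v) / 2)
  have hnorm : ∀ (z : ℂ) (x : Dual E),
      ‖Complex.exp (z * x.eval u + Complex.I * x.eval v)‖ = Real.exp (z.re * x.eval u) := by
    intro z x
    rw [Complex.norm_exp]
    simp
  have hdiff : Differentiable ℂ L := by
    intro z₀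
    refine (hasDerivAt_integral_of_dominated_loc_of_deriv_le
      (F := fun z (x : Dual E) => Complex.exp (z * x.eval u + Complex.I * x.eval v))
      (F' := fun z (x : Dual E) => Complex.exp (z * x.eval u + Complex.I * x.eval v) * x.eval u)
      (bound := fun x => Real.exp (|x.eval ((‖z₀‖ + 2) • u)| + |x.eval 0|))
      (Metric.ball_mem_nhds z₀ one_pos) ?_ ?_ ?_ ?_ ?_ ?_).2.differentiableAt
    · exact Eventually.of_forall fun z => Measurable.aestronglyMeasurable (by fun_prop)
    · refine (integrable_exp_eval hμ (z₀.re • u)).mono'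
        (Measurable.aestronglyMeasurable (by fun_prop)) (Eventually.of_forall fun x => ?_)
      rw [hnorm, eval_smul]
    · exact Measurable.aestronglyMeasurable (by fun_prop)
    · refine Eventually.of_forall fun x z hz => ?_
      rw [norm_mul, hnorm, Complex.norm_real, Real.norm_eq_abs, eval_smul, abs_mul,
        abs_of_nonneg (by positivity : 0 ≤ ‖z₀‖ + 2)]
      have h1 : |x.eval u| ≤ Real.exp |x.eval u| := by
        linarith [Real.add_one_le_exp |x.eval u|]
      have h2 : z.re * x.eval u ≤ (‖z₀‖ + 1) * |x.eval u| := by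
        refine (le_abs_self _).trans ?_
        rw [abs_mul]
        refine mul_le_mul_of_nonneg_right ((Complex.abs_re_le_norm z).trans ?_) (abs_nonneg _)
        have := norm_sub_norm_le z z₀
        rw [Metric.mem_ball, dist_eq_norm] at hz
        linarith
      calc Real.exp (z.re * x.eval u) * |x.eval u|
          ≤ Real.exp ((‖z₀‖ + 1) * |x.eval u|) * Real.exp |x.eval u| :=
            mul_le_mul (Real.exp_le_exp.2 h2) h1 (abs_nonneg _) (Real.exp_pos _).le
        _ = Real.exp ((‖z₀‖ + 2) * |x.eval u|) := by rw [← Real.exp_add]; ring_nf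
        _ ≤ _ := Real.exp_le_exp.2 (le_add_of_nonneg_right (abs_nonneg _))
    · exact integrable_exp_abs_add hμ _ _
    · refine Eventually.of_forall fun x z _ => ?_
      have h1 : HasDerivAt (fun z : ℂ => z * x.eval u + Complex.I * x.eval v) (x.eval u : ℂ) z := by
        simpa using ((hasDerivAt_id z).mul_const (x.eval u : ℂ)).add_const
          (Complex.I * x.eval v : ℂ)
      exact h1.cexp
  have hR : Differentiable ℂ R := by
    intro z
    fun_prop
  have himag : ∀ t : ℝ, L (t * Complex.I) = R (t * Complex.I) := by
    intro t
    have h := hμ.2 (t • u + v)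
    rw [← Complex.ofReal_pow, H.norm_sq] at h
    simp only [L, R]
    convert h using 2
    · ext x
      rw [eval_add, eval_smul]; push_cast; ring_nf
    · simp only [map_add, map_smul, LinearMap.add_apply, LinearMap.smul_apply, smul_eq_mul,
        H.symm 0 v u]
      push_cast
      rw [mul_pow, Complex.I_sq]
      linear_combination (2 * t * H.ip 0 u v / 2 : ℂ) * Complex.I_sq
  have hLR : L = R := by
    refine AnalyticOnNhd.eq_of_frequently_eq (z₀ := 0) (fun z _ => hdiff.analyticAt z)
      (fun z _ => hR.analyticAt z) ?_
    have ht : Tendsto (fun t : ℝ => (t * Complex.I : ℂ)) (𝓝[≠] 0) (𝓝[≠] 0) := by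
      refine tendsto_nhdsWithin_of_tendsto_nhds_of_eventually_within _
        ((Continuous.tendsto' (by fun_prop) _ _ (by simp)).mono_left nhdsWithin_le_nhds) ?_
      filter_upwards [self_mem_nhdsWithin] with t ht
      simpa using ht
    exact ht.frequently (Eventually.of_forall himag).frequently
  have h1 := congrFun hLR 1
  simp only [L, R, one_mul] at h1
  simp only [ceval_eq, ← hu, ← hv]
  rw [h1]
  congr 1
  apply Complex.ext
  · simp [cpair]; ring
  · simp [cpair, H.symm 0 ξ.im ξ.re]; ring

end CountablyHilbert

/-! ### Wick powers and the renormalized exponential -/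

/-- A Cauchy product in which the first index counts twice. -/
theorem hasSum_double_cauchy {R : Type*} [NormedRing R] [CompleteSpace R] {A B : ℕ → R} {a b : R}
    (hA : Summable fun n => ‖A n‖) (hB : Summable fun n => ‖B n‖) (ha : HasSum A a)
    (hb : HasSum B b) :
    HasSum (fun n => ∑ k ∈ Finset.range (n / 2 + 1), A k * B (n - 2 * k)) (a * b) := by
  have h1 : HasSum (fun p : ℕ × ℕ => A p.1 * B p.2) (a * b) :=
    ha.mul hb (summable_mul_of_summable_norm hA hB)
  let e : (Σ n : ℕ, Fin (n / 2 + 1)) ≃ ℕ × ℕ :=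
    { toFun := fun s => (s.2, s.1 - 2 * s.2)
      invFun := fun p => ⟨p.2 + 2 * p.1, ⟨p.1, by omega⟩⟩
      left_inv := by
        rintro ⟨n, ⟨k, hk⟩⟩
        have : n - 2 * k + 2 * k = n := by omega
        exact Sigma.ext this ((Fin.heq_ext_iff (by simp only [this])).2 rfl)
      right_inv := by
        rintro ⟨k, j⟩
        simp }
  have h2 := (e.hasSum_iff.2 h1).sigma fun n => hasSum_fintype _
  convert h2 using 2 with n
  rw [Finset.sum_range]
  rfl

/-- The terms of the series defining the renormalized exponential. -/
theorem inv_factorial_mul_wick_sum (n : ℕ) (c t : ℂ) :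
    (1 / (n.factorial : ℂ)) * ∑ k ∈ Finset.range (n / 2 + 1),
      (-1 : ℂ) ^ k * ((n.factorial : ℂ) / ((k.factorial : ℂ) * ((n - 2 * k).factorial : ℂ) * 2 ^ k)) *
        c ^ k * t ^ (n - 2 * k) =
    ∑ k ∈ Finset.range (n / 2 + 1),
      ((-c / 2) ^ k / k.factorial) * (t ^ (n - 2 * k) / (n - 2 * k).factorial) := by
  rw [Finset.mul_sum]
  refine Finset.sum_congr rfl fun k _ => ?_
  have h1 : (n.factorial : ℂ) ≠ 0 := Nat.cast_ne_zero.2 n.factorial_ne_zero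
  have h2 : (k.factorial : ℂ) ≠ 0 := Nat.cast_ne_zero.2 k.factorial_ne_zero
  have h3 : ((n - 2 * k).factorial : ℂ) ≠ 0 := Nat.cast_ne_zero.2 (Nat.factorial_ne_zero _)
  rw [div_pow, ← neg_one_mul c, mul_pow]
  field_simp

theorem hasSum_complex_exp (z : ℂ) : HasSum (fun n : ℕ => z ^ n / n.factorial) (Complex.exp z) := by
  rw [Complex.exp_eq_exp_ℂ]
  exact NormedSpace.expSeries_div_hasSum_exp z

theorem hasSum_real_exp (t : ℝ) : HasSum (fun n : ℕ => t ^ n / n.factorial) (Real.exp t) := by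
  rw [Real.exp_eq_exp_ℝ]
  exact NormedSpace.expSeries_div_hasSum_exp t

namespace Complexify

variable {E : Type*} [AddCommGroup E] [Module ℝ E]

/-- Complex conjugation on the complexification. -/
def conj (ξ : Complexify E) : Complexify E := mk ξ.re (-ξ.im)

@[simp] theorem conj_re (ξ : Complexify E) : ξ.conj.re = ξ.re := rfl
@[simp] theorem conj_im (ξ : Complexify E) : ξ.conj.im = -ξ.im := rfl
@[simp] theorem conj_conj (ξ : Complexify E) : ξ.conj.conj = ξ := by ext <;> simp

end Complexify

namespace CountablyHilbert

variable {E : Type*} [AddCommGroup E] [Module ℝ E] [UniformSpace E] (H : CountablyHilbert E)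

theorem cpair_apply (ξ η : Complexify E) : H.cpair ξ η =
    ⟨H.ip 0 ξ.re η.re - H.ip 0 ξ.im η.im, H.ip 0 ξ.re η.im + H.ip 0 ξ.im η.re⟩ := rfl

theorem cpair_comm (ξ η : Complexify E) : H.cpair ξ η = H.cpair η ξ := by
  rw [cpair_apply, cpair_apply]
  apply Complex.ext
  · simp [H.symm 0 η.re, H.symm 0 η.im]
  · simp [H.symm 0 η.re, H.symm 0 η.im]; ring

theorem cpair_conj (ξ η : Complexify E) :
    H.cpair ξ.conj η.conj = (starRingEnd ℂ) (H.cpair ξ η) := by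
  rw [cpair_apply, cpair_apply]
  apply Complex.ext
  · simp
  · simp; ring

theorem ceval_conj (x : Dual E) (ξ : Complexify E) :
    x.ceval ξ.conj = (starRingEnd ℂ) (x.ceval ξ) := by
  have h : x.eval (-ξ.im) = -x.eval ξ.im := map_neg (show E →L[ℝ] ℝ from x) _
  apply Complex.ext
  · simp [Dual.ceval]
  · simp [Dual.ceval, h]

theorem wickPow_conj (n : ℕ) (ξ : Complexify E) (x : Dual E) :
    H.wickPow n ξ.conj x = (starRingEnd ℂ) (H.wickPow n ξ x) := by
  simp [wickPow, cpair_conj, ceval_conj, Complex.conj_ofNat]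

theorem wickPow_smul (n : ℕ) (z : ℂ) (ξ : Complexify E) (x : Dual E) :
    H.wickPow n (z • ξ) x = z ^ n * H.wickPow n ξ x := by
  rw [wickPow, wickPow, Finset.mul_sum]
  refine Finset.sum_congr rfl fun k hk => ?_
  have hk : 2 * k ≤ n := by have := Finset.mem_range.1 hk; omega
  have h1 : H.cpair (z • ξ) (z • ξ) = z ^ 2 * H.cpair ξ ξ := by
    rw [map_smul, cpair_comm, map_smul, smul_eq_mul, smul_eq_mul]; ring
  have h2 : z ^ n = (z ^ 2) ^ k * z ^ (n - 2 * k) := by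
    rw [← pow_mul, ← pow_add, Nat.add_sub_cancel' hk]
  rw [h1, ceval_smul, mul_pow, mul_pow, h2]
  ring

theorem hasSum_wickPow (ξ : Complexify E) (x : Dual E) :
    HasSum (fun n : ℕ => (1 / (n.factorial : ℂ)) * H.wickPow n ξ x)
      (Complex.exp (x.ceval ξ - H.cpair ξ ξ / 2)) := by
  simp only [wickPow, inv_factorial_mul_wick_sum]
  have h := hasSum_double_cauchy (hasSum_complex_exp (-H.cpair ξ ξ / 2)).summable.norm
    (hasSum_complex_exp (x.ceval ξ)).summable.norm (hasSum_complex_exp (-H.cpair ξ ξ / 2))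
    (hasSum_complex_exp (x.ceval ξ))
  rwa [← Complex.exp_add, neg_div, add_comm, ← sub_eq_add_neg, ← neg_div] at h

theorem wickExp_eq (ξ : Complexify E) (x : Dual E) :
    H.wickExp ξ x = Complex.exp (x.ceval ξ - H.cpair ξ ξ / 2) :=
  (H.hasSum_wickPow ξ x).tsum_eq

theorem wickExp_conj (ξ : Complexify E) (x : Dual E) :
    H.wickExp ξ.conj x = (starRingEnd ℂ) (H.wickExp ξ x) := by
  rw [wickExp_eq, wickExp_eq, ← Complex.exp_conj, cpair_conj, ceval_conj]
  simp [Complex.conj_ofNat]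

/-- A majorant of the terms of the series of the renormalized exponential. -/
theorem exists_wickPow_majorant (ξ : Complexify E) (x : Dual E) : ∃ w : ℕ → ℝ,
    (∀ n, ‖(1 / (n.factorial : ℂ)) * H.wickPow n ξ x‖ ≤ w n) ∧
    HasSum w (Real.exp (‖H.cpair ξ ξ‖ / 2) * Real.exp ‖x.ceval ξ‖) := by
  refine ⟨_, fun n => ?_, hasSum_double_cauchy
    (hasSum_real_exp (‖H.cpair ξ ξ‖ / 2)).summable.norm
    (hasSum_real_exp ‖x.ceval ξ‖).summable.norm (hasSum_real_exp (‖H.cpair ξ ξ‖ / 2))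
    (hasSum_real_exp ‖x.ceval ξ‖)⟩
  rw [wickPow, inv_factorial_mul_wick_sum]
  refine (norm_sum_le _ _).trans (le_of_eq (Finset.sum_congr rfl fun k _ => ?_))
  simp

theorem norm_wickPow_le (n : ℕ) (ξ : Complexify E) (x : Dual E) :
    ‖H.wickPow n ξ x‖ ≤
      (n.factorial * Real.exp (‖H.cpair ξ ξ‖ / 2)) * Real.exp ‖x.ceval ξ‖ := by
  obtain ⟨w, hw, hs⟩ := H.exists_wickPow_majorant ξ x
  have h1 := (hw n).trans (le_hasSum hs n fun j _ => (_root_.norm_nonneg _).trans (hw j))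
  have h2 : (0 : ℝ) < n.factorial := Nat.cast_pos.2 n.factorial_pos
  rw [norm_mul, norm_div, norm_one, Complex.norm_natCast, one_div_mul_eq_div, div_le_iff₀ h2] at h1
  linarith

theorem measurable_wickPow (n : ℕ) (ξ : Complexify E) : Measurable (H.wickPow n ξ) := by
  have := measurable_ceval ξ
  unfold wickPow
  fun_prop

theorem measurable_wickExp (ξ : Complexify E) : Measurable (H.wickExp ξ) := by
  have h := measurable_ceval ξ
  have : H.wickExp ξ = fun x => Complex.exp (x.ceval ξ - H.cpair ξ ξ / 2) :=
    funext (H.wickExp_eq ξ)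
  rw [this]
  fun_prop

variable {H} {μ : Measure (Dual E)} (hμ : H.IsStandardGaussian μ)
include hμ

theorem memLp_exp_norm_ceval (ξ : Complexify E) :
    MemLp (fun x : Dual E => Real.exp ‖x.ceval ξ‖) 2 μ := by
  have hm := measurable_ceval ξ
  have hm2 : Measurable fun x : Dual E => Real.exp ‖x.ceval ξ‖ := by fun_prop
  rw [memLp_two_iff_integrable_sq hm2.aestronglyMeasurable]
  refine (integrable_exp_abs_add hμ ((2 : ℝ) • ξ.re) ((2 : ℝ) • ξ.im)).mono'
    (Measurable.aestronglyMeasurable (by fun_prop)) (Eventually.of_forall fun x => ?_)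
  rw [Real.norm_of_nonneg (sq_nonneg _), ← Real.exp_nat_mul, eval_smul, eval_smul, abs_mul, abs_mul]
  refine Real.exp_le_exp.2 ?_
  have : ‖x.ceval ξ‖ ≤ |x.eval ξ.re| + |x.eval ξ.im| := Complex.norm_le_abs_re_add_abs_im _
  simp only [Nat.cast_ofNat, abs_two]
  linarith

theorem memLp_wickPow (n : ℕ) (ξ : Complexify E) : MemLp (H.wickPow n ξ) 2 μ :=
  (memLp_exp_norm_ceval hμ ξ).of_le_mul (H.measurable_wickPow n ξ).aestronglyMeasurable
    (Eventually.of_forall fun x => by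
      rw [Real.norm_of_nonneg (Real.exp_pos _).le]; exact H.norm_wickPow_le n ξ x)

theorem memLp_wickExp (ξ : Complexify E) : MemLp (H.wickExp ξ) 2 μ := by
  refine (memLp_exp_norm_ceval hμ ξ).of_le_mul (c := Real.exp (‖H.cpair ξ ξ‖ / 2))
    (H.measurable_wickExp ξ).aestronglyMeasurable (Eventually.of_forall fun x => ?_)
  rw [Real.norm_of_nonneg (Real.exp_pos _).le, wickExp_eq, Complex.norm_exp, ← Real.exp_add]
  refine Real.exp_le_exp.2 ((Complex.re_le_norm _).trans ((norm_sub_le _ _).trans (le_of_eq ?_)))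
  rw [norm_div, Complex.norm_ofNat, add_comm]

theorem integral_wickExp_mul_wickExp (ξ η : Complexify E) :
    ∫ x, H.wickExp ξ x * H.wickExp η x ∂μ = Complex.exp (H.cpair ξ η) := by
  have h : ∀ x, H.wickExp ξ x * H.wickExp η x =
      Complex.exp (-(H.cpair ξ ξ / 2) - H.cpair η η / 2) * Complex.exp (x.ceval (ξ + η)) := by
    intro x
    rw [wickExp_eq, wickExp_eq, ← Complex.exp_add, ← Complex.exp_add, ceval_add]
    congr 1; ring
  simp only [h]
  rw [integral_const_mul, integral_exp_ceval hμ, ← Complex.exp_add]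
  congr 1
  rw [map_add, H.cpair_comm (ξ + η) ξ, H.cpair_comm (ξ + η) η, map_add, map_add, H.cpair_comm η ξ]
  ring

/-- Pairing the expansion of the renormalized exponential with a square integrable function. -/
theorem hasSum_integral_mul_wickPow {ψ : Dual E → ℂ} (hψ : MemLp ψ 2 μ) (ξ : Complexify E) (z : ℂ) :
    HasSum (fun n : ℕ => (1 / (n.factorial : ℂ) * ∫ x, ψ x * H.wickPow n ξ x ∂μ) * z ^ n)
      (∫ x, ψ x * H.wickExp (z • ξ) x ∂μ) := by
  choose w hw hs using H.exists_wickPow_majorant (z • ξ)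
  have hterm : ∀ n x, ψ x * (1 / (n.factorial : ℂ) * H.wickPow n (z • ξ) x) =
      (1 / (n.factorial : ℂ) * z ^ n) * (ψ x * H.wickPow n ξ x) := by
    intro n x; rw [wickPow_smul]; ring
  have key : HasSum (fun n : ℕ => ∫ x, ψ x * (1 / (n.factorial : ℂ) * H.wickPow n (z • ξ) x) ∂μ)
      (∫ x, ψ x * H.wickExp (z • ξ) x ∂μ) := by
    refine hasSum_integral_of_dominated_convergence (fun n x => ‖ψ x‖ * w x n) ?_ ?_ ?_ ?_ ?_
    · intro n
      exact hψ.aestronglyMeasurable.mul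
        ((H.measurable_wickPow n (z • ξ)).const_mul _).aestronglyMeasurable
    · intro n
      refine Eventually.of_forall fun x => ?_
      rw [norm_mul]
      exact mul_le_mul_of_nonneg_left (hw x n) (_root_.norm_nonneg _)
    · exact Eventually.of_forall fun x => (hs x).summable.mul_left _
    · have : (fun x => ∑' n, ‖ψ x‖ * w x n) = fun x =>
          ‖ψ x‖ * (Real.exp (‖H.cpair (z • ξ) (z • ξ)‖ / 2) * Real.exp ‖x.ceval (z • ξ)‖) :=
        funext fun x => ((hs x).mul_left _).tsum_eq
      rw [this]
      exact hψ.norm.integrable_mul ((memLp_exp_norm_ceval hμ (z • ξ)).const_mul _)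
    · refine Eventually.of_forall fun x => ?_
      rw [wickExp_eq]
      exact (H.hasSum_wickPow (z • ξ) x).mul_left _
  convert key using 2 with n
  simp only [hterm]
  rw [integral_const_mul]
  ring

theorem integral_wickExp_mul_wickPow (n : ℕ) (ξ η : Complexify E) :
    ∫ x, H.wickExp η x * H.wickPow n ξ x ∂μ = H.cpair ξ η ^ n := by
  have h1 := hasSum_integral_mul_wickPow hμ (memLp_wickExp hμ η) ξ
  have h2 : ∀ z : ℂ, HasSum (fun n : ℕ => (1 / (n.factorial : ℂ) * H.cpair ξ η ^ n) * z ^ n)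
      (∫ x, H.wickExp η x * H.wickExp (z • ξ) x ∂μ) := by
    intro z
    rw [integral_wickExp_mul_wickExp hμ, map_smul, smul_eq_mul, H.cpair_comm η ξ]
    convert hasSum_complex_exp (z * H.cpair ξ η) using 2
    rw [mul_pow]; ring
  have h3 := congrFun (coeff_eq_of_hasSum h1 h2) n
  exact mul_left_cancel₀ (one_div_ne_zero (Nat.cast_ne_zero.2 n.factorial_ne_zero)) h3

/-- Orthogonality relation of the Wick powers of equal degree. -/
theorem integral_wickPow_mul_wickPow (n : ℕ) (ξ η : Complexify E) :
    ∫ x, H.wickPow n ξ x * H.wickPow n η x ∂μ = n.factorial * H.cpair ξ η ^ n := by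
  have h1 := hasSum_integral_mul_wickPow hμ (memLp_wickPow hμ n ξ) η
  have h2 : ∀ z : ℂ, HasSum (fun m : ℕ => (if m = n then H.cpair ξ η ^ n else 0) * z ^ m)
      (∫ x, H.wickPow n ξ x * H.wickExp (z • η) x ∂μ) := by
    intro z
    have : ∫ x, H.wickPow n ξ x * H.wickExp (z • η) x ∂μ = H.cpair ξ η ^ n * z ^ n := by
      simp only [mul_comm (H.wickPow n ξ _)]
      rw [integral_wickExp_mul_wickPow hμ, map_smul, smul_eq_mul, mul_pow, mul_comm]
    rw [this]
    convert hasSum_single (f := fun m : ℕ => (if m = n then H.cpair ξ η ^ n else 0) * z ^ m) n ?_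
      using 1
    · simp
    · intro m hm; simp [hm]
  have h3 := congrFun (coeff_eq_of_hasSum h1 h2) n
  have h4 : (n.factorial : ℂ) ≠ 0 := Nat.cast_ne_zero.2 n.factorial_ne_zero
  simp only [if_true] at h3
  rw [← h3]
  field_simp

/-- The Wick power as an element of `(L²)`. -/
noncomputable def wickPowLp (n : ℕ) (ξ : Complexify E) : Lp ℂ 2 μ := (memLp_wickPow hμ n ξ).toLp _

/-- The renormalized exponential as an element of `(L²)`. -/
noncomputable def wickExpLp (ξ : Complexify E) : Lp ℂ 2 μ := (memLp_wickExp hμ ξ).toLp _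

theorem inner_wickPowLp (n : ℕ) (ξ η : Complexify E) :
    inner ℂ (wickPowLp hμ n ξ) (wickPowLp hμ n η) = n.factorial * H.cpair ξ.conj η ^ n := by
  rw [← integral_wickPow_mul_wickPow hμ, L2.inner_def]
  refine integral_congr_ae ?_
  filter_upwards [(memLp_wickPow hμ n ξ).coeFn_toLp, (memLp_wickPow hμ n η).coeFn_toLp]
    with x h1 h2
  rw [wickPowLp, wickPowLp, h1, h2, wickPow_conj]
  simp [mul_comm]

theorem inner_wickExpLp_wickPowLp (n : ℕ) (ξ η : Complexify E) :
    inner ℂ (wickExpLp hμ ξ.conj) (wickPowLp hμ n η) = H.cpair η ξ ^ n := by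
  rw [← integral_wickExp_mul_wickPow hμ, L2.inner_def]
  refine integral_congr_ae ?_
  filter_upwards [(memLp_wickExp hμ ξ.conj).coeFn_toLp, (memLp_wickPow hμ n η).coeFn_toLp]
    with x h1 h2
  rw [wickPowLp, wickExpLp, h1, h2, wickExp_conj]
  simp [mul_comm]

theorem sTransform_eq_inner (φ : Lp ℂ 2 μ) (ξ : Complexify E) :
    H.sTransform μ φ ξ = inner ℂ (wickExpLp hμ ξ.conj) φ := by
  rw [sTransform, L2.inner_def]
  refine integral_congr_ae ?_
  filter_upwards [(memLp_wickExp hμ ξ.conj).coeFn_toLp] with x h1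
  rw [wickExpLp, h1, wickExp_conj]
  simp

end CountablyHilbert

namespace CountablyHilbert

variable {E : Type*} [AddCommGroup E] [Module ℝ E] [UniformSpace E] (H : CountablyHilbert E)

/-! ### Density of the tensor powers of vectors -/

/-- The form of the elementary tensor `ξ_1 ⊗ ⋯ ⊗ ξ_n`. -/
noncomputable def elemTensor {n : ℕ} (ξ : Fin n → Complexify E) :
    MultilinearMap ℂ (fun _ : Fin n => Complexify E) ℂ :=
  (MultilinearMap.mkPiAlgebra ℂ (Fin n) ℂ).compLinearMap fun k => H.cpair (ξ k)

theorem elemTensor_apply {n : ℕ} (ξ η : Fin n → Complexify E) :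
    H.elemTensor ξ η = ∏ k, H.cpair (ξ k) (η k) := rfl

theorem tensorPow_apply (n : ℕ) (ξ : Complexify E) (η : Fin n → Complexify E) :
    H.tensorPow n ξ η = ∏ k, H.cpair ξ (η k) := rfl

theorem cpair_ofReal (u v : E) :
    H.cpair (Complexify.ofReal u) (Complexify.ofReal v) = (H.ip 0 u v : ℂ) := by
  rw [cpair_apply]
  apply Complex.ext <;> simp [Complexify.ofReal]

theorem sum_perm_elemTensor {n : ℕ} (ξ : Fin n → Complexify E) :
    ∑ σ : Equiv.Perm (Fin n), H.elemTensor (fun k => ξ (σ k)) =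
      ∑ T : Finset (Fin n), (-1 : ℂ) ^ T.card • H.tensorPow n (∑ j ∈ Tᶜ, ξ j) := by
  ext η
  have h := sum_perm_eq_sum_diagonal (H.elemTensor η) ξ
  simp only [elemTensor_apply, H.cpair_comm (η _)] at h
  simpa [_root_.sum_apply, elemTensor_apply, tensorPow_apply] using h

/-- A symmetric form restricted to the span of a finite family is a combination of powers. -/
theorem exists_tensorPow_eq {n m : ℕ} (f : MultilinearMap ℂ (fun _ : Fin n => Complexify E) ℂ)
    (hs : ∀ (σ : Equiv.Perm (Fin n)) (η : Fin n → Complexify E), f (fun k => η (σ k)) = f η)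
    (e : Fin m → Complexify E) :
    ∃ (N : ℕ) (c : Fin N → ℂ) (ξ : Fin N → Complexify E),
      ∑ i : Fin n → Fin m, f (fun k => e (i k)) • H.elemTensor (fun k => e (i k)) =
        ∑ j, c j • H.tensorPow n (ξ j) := by
  let ι := (Fin n → Fin m) × Finset (Fin n)
  let c : ι → ℂ := fun s =>
    (n.factorial : ℂ)⁻¹ * f (fun k => e (s.1 k)) * (-1 : ℂ) ^ s.2.card
  let ξ : ι → Complexify E := fun s => ∑ j ∈ s.2ᶜ, e (s.1 j)
  have hfac : (n.factorial : ℂ) ≠ 0 := Nat.cast_ne_zero.2 n.factorial_ne_zero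
  have hperm : ∀ σ : Equiv.Perm (Fin n),
      ∑ i : Fin n → Fin m, f (fun k => e (i k)) • H.elemTensor (fun k => e (i (σ k))) =
        ∑ i : Fin n → Fin m, f (fun k => e (i k)) • H.elemTensor (fun k => e (i k)) := by
    intro σ
    refine Fintype.sum_equiv (Equiv.arrowCongr σ.symm (Equiv.refl _)) _ _ fun i => ?_
    have : f (fun k => e (i (σ k))) = f (fun k => e (i k)) := hs σ fun k => e (i k)
    simp [Equiv.arrowCongr, Function.comp_def, this]
  have key : ∑ i : Fin n → Fin m, f (fun k => e (i k)) • H.elemTensor (fun k => e (i k)) =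
      ∑ s : ι, c s • H.tensorPow n (ξ s) := by
    have h1 : (n.factorial : ℂ) •
        ∑ i : Fin n → Fin m, f (fun k => e (i k)) • H.elemTensor (fun k => e (i k)) =
        ∑ i : Fin n → Fin m, f (fun k => e (i k)) •
          ∑ σ : Equiv.Perm (Fin n), H.elemTensor (fun k => e (i (σ k))) := by
      simp only [Finset.smul_sum]
      rw [Finset.sum_comm]
      simp only [← Finset.smul_sum, hperm]
      rw [Finset.sum_const, Finset.card_univ, Fintype.card_perm, Fintype.card_fin,
        Nat.cast_smul_eq_nsmul]
    have h2 := congrArg (fun g => (n.factorial : ℂ)⁻¹ • g) h1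
    simp only [smul_smul, inv_mul_cancel₀ hfac, one_smul] at h2
    rw [h2, Fintype.sum_prod_type, Finset.smul_sum]
    refine Finset.sum_congr rfl fun i _ => ?_
    have h3 := H.sum_perm_elemTensor (fun k => e (i k))
    rw [h3, Finset.smul_sum, Finset.smul_sum]
    refine Finset.sum_congr rfl fun T _ => ?_
    simp only [smul_smul, c, ξ, mul_assoc]
  let eq := Fintype.equivFin ι
  refine ⟨Fintype.card ι, c ∘ eq.symm, ξ ∘ eq.symm, ?_⟩
  rw [key]
  exact Fintype.sum_equiv eq _ _ fun s => by simp

/-- The Hilbert-Schmidt norm of a form on a finite-dimensional subspace dominates the sums over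
its orthonormal families. -/
theorem IsOrtho.sum_norm_sq_le {n m M : ℕ}
    (f : MultilinearMap ℂ (fun _ : Fin n => Complexify E) ℂ) {B : LinearMap.BilinForm ℝ E}
    (hsymm : ∀ x y, B x y = B y x) {b : Fin M → E} {e : Fin m → E} (hb : IsOrtho B b)
    (he : IsOrtho B e) (hspan : ∀ j, e j ∈ Submodule.span ℝ (Set.range b)) :
    ∑ i : Fin n → Fin m, ‖f (fun k => Complexify.ofReal (e (i k)))‖ ^ 2 ≤
      ∑ i : Fin n → Fin M, ‖f (fun k => Complexify.ofReal (b (i k)))‖ ^ 2 := by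
  have hO : ∀ j k, ∑ l, B (e j) (b l) * B (e k) (b l) = if j = k then 1 else 0 := by
    intro j k
    rw [← hb.apply_eq_sum hsymm (hspan j), he j k]
  have hexp : ∀ j, Complexify.ofReal (e j) =
      ∑ l, ((B (e j) (b l) : ℝ) : ℂ) • Complexify.ofReal (b l) := by
    intro j
    have h := Complexify.sum_smul_ofReal (fun l => B (e j) (b l)) (fun _ => 0) b
    rw [← hb.eq_sum (hspan j)] at h
    simp only [zero_smul, Finset.sum_const_zero] at h
    exact h.symm
  have h := sum_norm_sq_tensor_le _ hO fun i : Fin n → Fin M =>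
    f (fun k => Complexify.ofReal (b (i k)))
  refine le_trans (le_of_eq (Finset.sum_congr rfl fun i' _ => ?_)) h
  simp only [hexp]
  rw [f.map_sum fun k l => ((B (e (i' k)) (b l) : ℝ) : ℂ) • Complexify.ofReal (b l)]
  simp only [f.map_smul_univ, smul_eq_mul, Complex.ofReal_prod]

/-- Linear combinations of powers `ξ^{⊗n}` are dense in the symmetric tensor power: a form is
approximated by its restrictions to finite-dimensional subspaces. -/
theorem IsSymTensor.exists_tensorPow_approx {n : ℕ}
    {f : MultilinearMap ℂ (fun _ : Fin n => Complexify E) ℂ} (hf : H.IsSymTensor f)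
    {ε : ℝ} (hε : 0 < ε) :
    ∃ (m : ℕ) (c : Fin m → ℂ) (ξ : Fin m → Complexify E),
      H.tensorNormSq 0 (f - ∑ j, c j • H.tensorPow n (ξ j)) ≤ ENNReal.ofReal ε := by
  classical
  obtain ⟨hs, hfin⟩ := hf
  obtain ⟨m, e, he, hle⟩ : ∃ (m : ℕ) (e : Fin m → E), IsOrtho (H.ip 0) e ∧ H.tensorNormSq 0 f ≤
      ENNReal.ofReal (∑ i : Fin n → Fin m, ‖f (fun k => Complexify.ofReal (e (i k)))‖ ^ 2) +
        ENNReal.ofReal ε := by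
    by_contra! hcon
    have h1 : H.tensorNormSq 0 f ≤ H.tensorNormSq 0 f - ENNReal.ofReal ε :=
      H.tensorNormSq_le f fun m e he =>
        ENNReal.le_sub_of_add_le_right ENNReal.ofReal_ne_top
          (hcon m e ((H.isNegOrthonormal_zero_iff e).1 he)).le
    have h2 := hcon 0 (fun j => j.elim0) (fun j => j.elim0)
    exact absurd h1 (not_le.2 (ENNReal.sub_lt_self hfin.ne (pos_of_gt h2).ne'
      (ENNReal.ofReal_pos.2 hε).ne'))
  obtain ⟨N, c, ξ, hg⟩ := H.exists_tensorPow_eq f hs (fun j => Complexify.ofReal (e j))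
  refine ⟨N, c, ξ, ?_⟩
  rw [← hg]
  set g := ∑ i : Fin n → Fin m, f (fun k => Complexify.ofReal (e (i k))) •
    H.elemTensor (fun k => Complexify.ofReal (e (i k))) with hgdef
  refine H.tensorNormSq_le _ fun m' e' he' => ?_
  rw [isNegOrthonormal_zero_iff] at he'
  obtain ⟨M, b, ι, hb, hι, hspan⟩ := he.exists_extension (H.symm 0) (H.pos 0) (List.ofFn e')
  have hspan' : ∀ j, e' j ∈ Submodule.span ℝ (Set.range b) := fun j =>
    hspan _ (List.mem_ofFn.2 ⟨j, rfl⟩)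
  refine ENNReal.ofReal_le_ofReal ((IsOrtho.sum_norm_sq_le (f - g) (H.symm 0) hb he' hspan').trans ?_)
  have hgb : ∀ i : Fin n → Fin M, g (fun k => Complexify.ofReal (b (i k))) =
      ∑ i₀ : Fin n → Fin m, if (fun k => ι (i₀ k)) = i then
        f (fun k => Complexify.ofReal (b (i k))) else 0 := by
    intro i
    rw [hgdef, _root_.sum_apply]
    refine Finset.sum_congr rfl fun i₀ _ => ?_
    rw [_root_.smul_apply, elemTensor_apply, smul_eq_mul]
    simp only [cpair_ofReal, ← hι, hb _ _]
    by_cases h : (fun k => ι (i₀ k)) = i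
    · subst h; simp
    · obtain ⟨k, hk⟩ := Function.ne_iff.1 h
      rw [if_neg h, Finset.prod_eq_zero (Finset.mem_univ k), mul_zero]
      rw [if_neg hk, Complex.ofReal_zero]
  let R : Finset (Fin n → Fin M) := Finset.univ.image fun (i₀ : Fin n → Fin m) k => ι (i₀ k)
  have hinj : Function.Injective fun (i₀ : Fin n → Fin m) (k : Fin n) => ι (i₀ k) := by
    intro i j hij
    ext k
    exact congrArg Fin.val (ι.injective (congrFun hij k))
  have hdiff : ∀ i : Fin n → Fin M, ‖(f - g) (fun k => Complexify.ofReal (b (i k)))‖ ^ 2 =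
      ‖f (fun k => Complexify.ofReal (b (i k)))‖ ^ 2 -
        if i ∈ R then ‖f (fun k => Complexify.ofReal (b (i k)))‖ ^ 2 else 0 := by
    intro i
    rw [_root_.sub_apply, hgb]
    by_cases h : i ∈ R
    · obtain ⟨i₀, -, rfl⟩ := Finset.mem_image.1 h
      rw [Finset.sum_eq_single i₀, if_pos rfl, if_pos h]
      · simp
      · intro j _ hj
        exact if_neg fun hh => hj (hinj hh)
      · simp
    · rw [if_neg h, Finset.sum_eq_zero]
      · simp
      · intro i₀ _
        exact if_neg fun hh => h (Finset.mem_image.2 ⟨i₀, Finset.mem_univ _, hh⟩)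
  have hR : ∑ i : Fin n → Fin M, (if i ∈ R then ‖f (fun k => Complexify.ofReal (b (i k)))‖ ^ 2
      else 0) = ∑ i₀ : Fin n → Fin m, ‖f (fun k => Complexify.ofReal (e (i₀ k)))‖ ^ 2 := by
    rw [← Finset.sum_filter, Finset.filter_mem_eq_inter, Finset.univ_inter,
      Finset.sum_image fun i _ j _ h => hinj h]
    simp only [hι]
  simp only [hdiff]
  rw [Finset.sum_sub_distrib, hR]
  have h3 := (H.sum_le_tensorNormSq f ((H.isNegOrthonormal_zero_iff b).2 hb)).trans hle
  rw [← ENNReal.ofReal_add (Finset.sum_nonneg fun _ _ => sq_nonneg _) hε.le,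
    ENNReal.ofReal_le_ofReal_iff
      (add_nonneg (Finset.sum_nonneg fun _ _ => sq_nonneg _) hε.le)] at h3
  linarith

/-! ### Multiple Wiener integrals -/

variable {H} {μ : Measure (Dual E)} (hμ : H.IsStandardGaussian μ)

theorem cpair_conj_eq_sum {M : ℕ} {b : Fin M → E} (hb : IsOrtho (H.ip 0) b) {ξ : Complexify E}
    (hre : ξ.re ∈ Submodule.span ℝ (Set.range b)) (him : ξ.im ∈ Submodule.span ℝ (Set.range b))
    (η : Complexify E) :
    H.cpair ξ.conj η = ∑ l, (starRingEnd ℂ) (H.cpair ξ (Complexify.ofReal (b l))) *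
      H.cpair η (Complexify.ofReal (b l)) := by
  have key := fun (v : E) (hv : v ∈ Submodule.span ℝ (Set.range b)) (w : E) =>
    hb.apply_eq_sum (H.symm 0) hv w
  simp only [cpair_apply]
  apply Complex.ext
  · simp only [Complexify.conj_re, Complexify.conj_im, map_neg, LinearMap.neg_apply]
    rw [key _ hre η.re, key _ him η.im, Complex.re_sum, sub_neg_eq_add, ← Finset.sum_add_distrib]
    refine Finset.sum_congr rfl fun l _ => ?_
    simp [Complexify.ofReal]
  · simp only [Complexify.conj_re, Complexify.conj_im, map_neg, LinearMap.neg_apply]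
    rw [key _ hre η.im, key _ him η.re, Complex.im_sum, ← Finset.sum_neg_distrib,
      ← Finset.sum_add_distrib]
    refine Finset.sum_congr rfl fun l _ => ?_
    simp [Complexify.ofReal]

include hμ

/-- The Itô isometry, as an upper bound. -/
theorem ofReal_norm_sq_sum_wickPowLp_le {ι : Type*} [Fintype ι] (n : ℕ) (c : ι → ℂ)
    (ξ : ι → Complexify E) :
    ENNReal.ofReal (‖∑ j, c j • wickPowLp hμ n (ξ j)‖ ^ 2) ≤
      n.factorial * H.tensorNormSq 0 (∑ j, c j • H.tensorPow n (ξ j)) := by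
  obtain ⟨M, b, hb, hspan⟩ := exists_isOrtho_span (H.symm 0) (H.pos 0)
    ((Finset.univ.toList.map fun j => (ξ j).re) ++ Finset.univ.toList.map fun j => (ξ j).im)
  have hre : ∀ j, (ξ j).re ∈ Submodule.span ℝ (Set.range b) := fun j =>
    hspan _ (List.mem_append_left _ (List.mem_map.2 ⟨j, by simp, rfl⟩))
  have him : ∀ j, (ξ j).im ∈ Submodule.span ℝ (Set.range b) := fun j =>
    hspan _ (List.mem_append_right _ (List.mem_map.2 ⟨j, by simp, rfl⟩))
  set T := ∑ j, c j • H.tensorPow n (ξ j) with hT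
  have hTb : ∀ i : Fin n → Fin M, T (fun k => Complexify.ofReal (b (i k))) =
      ∑ j, c j * ∏ k, H.cpair (ξ j) (Complexify.ofReal (b (i k))) := by
    intro i
    simp [hT, tensorPow_apply]
  have key : ((‖∑ j, c j • wickPowLp hμ n (ξ j)‖ ^ 2 : ℝ) : ℂ) =
      ((n.factorial * ∑ i : Fin n → Fin M, ‖T (fun k => Complexify.ofReal (b (i k)))‖ ^ 2 : ℝ) :
        ℂ) := by
    have h1 := inner_self_eq_norm_sq_to_K (𝕜 := ℂ) (∑ j, c j • wickPowLp hμ n (ξ j))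
    push_cast
    refine h1.symm.trans ?_
    simp only [sum_inner, inner_sum, inner_smul_left, inner_smul_right, inner_wickPowLp]
    have h2 : ∀ i : Fin n → Fin M, (‖T (fun k => Complexify.ofReal (b (i k)))‖ : ℂ) ^ 2 =
        ∑ j, ∑ j', (starRingEnd ℂ) (c j) * (c j' *
          ∏ k, ((starRingEnd ℂ) (H.cpair (ξ j) (Complexify.ofReal (b (i k)))) *
            H.cpair (ξ j') (Complexify.ofReal (b (i k))))) := by
      intro i
      rw [← Complex.conj_mul', hTb, map_sum, Finset.sum_mul_sum]
      refine Finset.sum_congr rfl fun j _ => Finset.sum_congr rfl fun j' _ => ?_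
      rw [map_mul, map_prod, Finset.prod_mul_distrib]
      ring
    have h3 : ∑ i : Fin n → Fin M, (‖T (fun k => Complexify.ofReal (b (i k)))‖ : ℂ) ^ 2 =
        ∑ j, ∑ j', (starRingEnd ℂ) (c j) * (c j' * H.cpair (ξ j).conj (ξ j') ^ n) := by
      simp only [h2]
      rw [Finset.sum_comm]
      refine Finset.sum_congr rfl fun j _ => ?_
      rw [Finset.sum_comm]
      refine Finset.sum_congr rfl fun j' _ => ?_
      rw [cpair_conj_eq_sum hb (hre j) (him j), Fintype.sum_pow, ← Finset.mul_sum,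
        ← Finset.mul_sum]
    rw [h3]
    simp only [Finset.mul_sum]
    rw [Finset.sum_comm]
    refine Finset.sum_congr rfl fun j _ => Finset.sum_congr rfl fun j' _ => ?_
    ring
  rw [Complex.ofReal_inj] at key
  rw [key, ENNReal.ofReal_mul (Nat.cast_nonneg _), ENNReal.ofReal_natCast]
  gcongr
  exact H.sum_le_tensorNormSq T ((H.isNegOrthonormal_zero_iff b).2 hb)

end CountablyHilbert

namespace CountablyHilbert

variable {E : Type*} [AddCommGroup E] [Module ℝ E] [UniformSpace E] {H : CountablyHilbert E}
  {μ : Measure (Dual E)} (hμ : H.IsStandardGaussian μ)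
include hμ

theorem isWienerIntegral_iff {n : ℕ} {f : MultilinearMap ℂ (fun _ : Fin n => Complexify E) ℂ}
    {φ : Lp ℂ 2 μ} : H.IsWienerIntegral μ n f φ ↔
      ∀ ε : ℝ, 0 < ε → ∃ (m : ℕ) (c : Fin m → ℂ) (ξ : Fin m → Complexify E),
        H.tensorNormSq 0 (f - ∑ j, c j • H.tensorPow n (ξ j)) ≤ ENNReal.ofReal ε ∧
        ‖φ - ∑ j, c j • wickPowLp hμ n (ξ j)‖ ≤ ε := by
  refine forall_congr' fun ε => forall_congr' fun hε => exists_congr fun m => exists_congr fun c =>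
    exists_congr fun ξ => and_congr_right fun _ => ?_
  have h1 : (fun x => φ x - ∑ j, c j * H.wickPow n (ξ j) x) =ᵐ[μ]
      (φ - ∑ j, c j • wickPowLp hμ n (ξ j) : Lp ℂ 2 μ) := by
    have h2 : ∀ j, ((c j • wickPowLp hμ n (ξ j) : Lp ℂ 2 μ) : Dual E → ℂ) =ᵐ[μ]
        fun x => c j * H.wickPow n (ξ j) x := by
      intro j
      filter_upwards [Lp.coeFn_smul (c j) (wickPowLp hμ n (ξ j)),
        (memLp_wickPow hμ n (ξ j)).coeFn_toLp] with x h3 h4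
      rw [h3, Pi.smul_apply, wickPowLp, h4, smul_eq_mul]
    have h5 : ∀ s : Finset (Fin m), ((∑ j ∈ s, c j • wickPowLp hμ n (ξ j) : Lp ℂ 2 μ) :
        Dual E → ℂ) =ᵐ[μ] fun x => ∑ j ∈ s, c j * H.wickPow n (ξ j) x := by
      intro s
      induction s using Finset.induction_on with
      | empty =>
        simp only [Finset.sum_empty]
        exact Lp.coeFn_zero ℂ 2 μ
      | insert a s ha ih =>
        rw [Finset.sum_insert ha]
        filter_upwards [Lp.coeFn_add (c a • wickPowLp hμ n (ξ a))
          (∑ j ∈ s, c j • wickPowLp hμ n (ξ j)), ih, h2 a] with x h6 h7 h8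
        rw [h6, Pi.add_apply, h7, h8, Finset.sum_insert ha]
    filter_upwards [Lp.coeFn_sub φ (∑ j, c j • wickPowLp hμ n (ξ j)), h5 Finset.univ] with x h6 h7
    rw [h6, Pi.sub_apply, h7]
  rw [eLpNorm_congr_ae h1, Lp.norm_def, ENNReal.le_ofReal_iff_toReal_le (Lp.eLpNorm_ne_top _) hε.le]

/-- Two combinations of powers close to the same tensor have close Wick polynomials. -/
theorem norm_sq_sub_le {ι κ : Type*} [Fintype ι] [Fintype κ] {n : ℕ}
    {f : MultilinearMap ℂ (fun _ : Fin n => Complexify E) ℂ} {c : ι → ℂ} {ξ : ι → Complexify E}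
    {d : κ → ℂ} {η : κ → Complexify E} {a b : ℝ} (ha : 0 ≤ a) (hb : 0 ≤ b)
    (hc : H.tensorNormSq 0 (f - ∑ j, c j • H.tensorPow n (ξ j)) ≤ ENNReal.ofReal a)
    (hd : H.tensorNormSq 0 (f - ∑ j, d j • H.tensorPow n (η j)) ≤ ENNReal.ofReal b) :
    ‖∑ j, c j • wickPowLp hμ n (ξ j) - ∑ j, d j • wickPowLp hμ n (η j)‖ ^ 2 ≤
      n.factorial * (2 * (a + b)) := by
  have h := ofReal_norm_sq_sum_wickPowLp_le hμ n (Sum.elim c (-d)) (Sum.elim ξ η)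
  simp only [Fintype.sum_sum_type, Sum.elim_inl, Sum.elim_inr, Pi.neg_apply, neg_smul,
    Finset.sum_neg_distrib, ← sub_eq_add_neg] at h
  have h2 := H.tensorNormSq_sub_le (p := 0) (f - ∑ j, d j • H.tensorPow n (η j))
    (f - ∑ j, c j • H.tensorPow n (ξ j))
  rw [sub_sub_sub_cancel_left, add_comm] at h2
  have h3 : (n.factorial : ℝ≥0∞) * (2 * (ENNReal.ofReal a + ENNReal.ofReal b)) =
      ENNReal.ofReal (n.factorial * (2 * (a + b))) := by
    rw [ENNReal.ofReal_mul (Nat.cast_nonneg _), ENNReal.ofReal_mul zero_le_two,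
      ENNReal.ofReal_add ha hb, ENNReal.ofReal_natCast, ENNReal.ofReal_ofNat]
  rw [← ENNReal.ofReal_le_ofReal_iff (by positivity), ← h3]
  exact h.trans (mul_le_mul_right (h2.trans (mul_le_mul_right (add_le_add hc hd) 2)) _)

/-- Existence of the multiple Wiener integral, with a bound on its norm (the factor `2`, absent from
the exact isometry, comes from `|f + g|² ≤ 2 (|f|² + |g|²)`). -/
theorem exists_isWienerIntegral {n : ℕ}
    {f : MultilinearMap ℂ (fun _ : Fin n => Complexify E) ℂ} (hf : H.IsSymTensor f) :
    ∃ g : Lp ℂ 2 μ, H.IsWienerIntegral μ n f g ∧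
      ‖g‖ ^ 2 ≤ n.factorial * (2 * (H.tensorNormSq 0 f).toReal) := by
  have hε : ∀ k : ℕ, (0 : ℝ) < 1 / ((k : ℝ) + 1) := fun k => Nat.one_div_pos_of_nat
  choose m c ξ hc using fun k : ℕ => hf.exists_tensorPow_approx H (hε k)
  let w : ℕ → Lp ℂ 2 μ := fun k => ∑ j, c k j • wickPowLp hμ n (ξ k j)
  have hdist : ∀ k l, ‖w k - w l‖ ^ 2 ≤
      n.factorial * (2 * (1 / ((k : ℝ) + 1) + 1 / ((l : ℝ) + 1))) := by
    intro k l
    exact norm_sq_sub_le hμ (hε k).le (hε l).le (hc k) (hc l)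
  have hnorm : ∀ k, ‖w k‖ ^ 2 ≤
      n.factorial * (2 * (1 / ((k : ℝ) + 1) + (H.tensorNormSq 0 f).toReal)) := by
    intro k
    have h1 := norm_sq_sub_le hμ (d := (Fin.elim0 : Fin 0 → ℂ)) (η := Fin.elim0) (hε k).le
      ENNReal.toReal_nonneg (hc k) (by simpa using (ENNReal.ofReal_toReal hf.2.ne).ge)
    simpa [w] using h1
  have hz := tendsto_one_div_add_atTop_nhds_zero_nat (𝕜 := ℝ)
  have hcauchy : CauchySeq w := by
    rw [Metric.cauchySeq_iff']
    intro ε hε'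
    have ht : Tendsto (fun k : ℕ => (n.factorial : ℝ) *
        (2 * (1 / ((k : ℝ) + 1) + 1 / ((k : ℝ) + 1)))) atTop (𝓝 0) := by
      simpa using ((hz.add hz).const_mul 2).const_mul (n.factorial : ℝ)
    obtain ⟨N, hN⟩ := (ht.eventually (gt_mem_nhds (pow_pos hε' 2))).exists
    refine ⟨N, fun k hk => ?_⟩
    rw [dist_eq_norm]
    refine lt_of_pow_lt_pow_left₀ 2 hε'.le ((hdist k N).trans_lt (lt_of_le_of_lt ?_ hN))
    have : 1 / ((k : ℝ) + 1) ≤ 1 / ((N : ℝ) + 1) := Nat.one_div_le_one_div hk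
    gcongr
  obtain ⟨g, hg⟩ := cauchySeq_tendsto_of_complete hcauchy
  refine ⟨g, (isWienerIntegral_iff hμ).2 fun ε hε' => ?_, ?_⟩
  · have h1 : ∀ᶠ k in atTop, ‖g - w k‖ < ε := by
      have := ((tendsto_const_nhds (x := g)).sub hg).norm
      rw [sub_self, norm_zero] at this
      exact this.eventually (gt_mem_nhds hε')
    obtain ⟨k, hk1, hk2⟩ := (h1.and (hz.eventually (gt_mem_nhds hε'))).exists
    exact ⟨m k, c k, ξ k, (hc k).trans (ENNReal.ofReal_le_ofReal hk2.le), hk1.le⟩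
  · have h1 : Tendsto (fun k : ℕ => (n.factorial : ℝ) *
        (2 * (1 / ((k : ℝ) + 1) + (H.tensorNormSq 0 f).toReal))) atTop
        (𝓝 (n.factorial * (2 * (H.tensorNormSq 0 f).toReal))) := by
      simpa using ((hz.add_const (H.tensorNormSq 0 f).toReal).const_mul 2).const_mul
        (n.factorial : ℝ)
    exact le_of_tendsto_of_tendsto' (hg.norm.pow 2) h1 hnorm

theorem IsWienerIntegral.unique {n : ℕ}
    {f : MultilinearMap ℂ (fun _ : Fin n => Complexify E) ℂ} {g g' : Lp ℂ 2 μ}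
    (hg : H.IsWienerIntegral μ n f g) (hg' : H.IsWienerIntegral μ n f g') : g = g' := by
  rw [isWienerIntegral_iff hμ] at hg hg'
  have key : ∀ ε : ℝ, 0 < ε → ‖g - g'‖ ≤ 2 * ε + Real.sqrt (n.factorial * (2 * (ε + ε))) := by
    intro ε hε
    obtain ⟨m, c, ξ, h1, h2⟩ := hg ε hε
    obtain ⟨m', c', ξ', h1', h2'⟩ := hg' ε hε
    have h3 := norm_sq_sub_le hμ hε.le hε.le h1 h1'
    have h4 := Real.le_sqrt_of_sq_le h3
    set w := ∑ j, c j • wickPowLp hμ n (ξ j)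
    set w' := ∑ j, c' j • wickPowLp hμ n (ξ' j)
    have h5 : g - g' = (g - w) + (w - w') - (g' - w') := by abel
    rw [h5]
    have h6 := norm_sub_le ((g - w) + (w - w')) (g' - w')
    have h7 := norm_add_le (g - w) (w - w')
    linarith
  have ht : Tendsto (fun ε : ℝ => 2 * ε + Real.sqrt (n.factorial * (2 * (ε + ε)))) (𝓝[>] 0)
      (𝓝 0) :=
    (Continuous.tendsto' (by fun_prop) _ _ (by simp)).mono_left nhdsWithin_le_nhds
  have h0 : ‖g - g'‖ ≤ 0 := ge_of_tendsto ht (by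
    filter_upwards [self_mem_nhdsWithin] with ε hε using key ε hε)
  exact sub_eq_zero.1 (norm_le_zero_iff.1 h0)

/-- The `S`-transform of a multiple Wiener integral. -/
theorem IsWienerIntegral.sTransform_eq (h0 : ∀ p ξ, H.norm 0 ξ ≤ H.norm p ξ) {n : ℕ}
    {f : MultilinearMap ℂ (fun _ : Fin n => Complexify E) ℂ} {g : Lp ℂ 2 μ}
    (hg : H.IsWienerIntegral μ n f g) (ξ : Complexify E) :
    H.sTransform μ g ξ = f (fun _ => ξ) := by
  rw [isWienerIntegral_iff hμ] at hg
  rw [sTransform_eq_inner hμ]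
  set v := wickExpLp hμ ξ.conj with hv
  have key : ∀ ε : ℝ, 0 < ε → ‖inner ℂ v g - f (fun _ => ξ)‖ ≤
      ‖v‖ * ε + Real.sqrt (ε * (H.cnegNorm 0 ξ ^ 2) ^ n) := by
    intro ε hε
    obtain ⟨m, c, η, h1, h2⟩ := hg ε hε
    set w := ∑ j, c j • wickPowLp hμ n (η j) with hw
    set T := ∑ j, c j • H.tensorPow n (η j) with hT
    have h3 : inner ℂ v w = T (fun _ => ξ) := by
      rw [hw, hT, inner_sum, _root_.sum_apply]
      refine Finset.sum_congr rfl fun j _ => ?_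
      rw [inner_smul_right, hv, inner_wickExpLp_wickPowLp, _root_.smul_apply, tensorPow_apply]
      simp
    have h4 : inner ℂ v g - f (fun _ => ξ) = inner ℂ v (g - w) - (f - T) (fun _ => ξ) := by
      rw [inner_sub_right, h3, _root_.sub_apply]; ring
    rw [h4]
    refine (norm_sub_le _ _).trans (add_le_add ?_ ?_)
    · exact (norm_inner_le_norm v _).trans (mul_le_mul_of_nonneg_left h2 (_root_.norm_nonneg v))
    · refine Real.le_sqrt_of_sq_le ?_
      refine (H.norm_sq_diagonal_le h0 (f - T) (h1.trans_lt ENNReal.ofReal_lt_top).ne ξ).trans ?_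
      exact mul_le_mul_of_nonneg_right (ENNReal.toReal_le_of_le_ofReal hε.le h1) (by positivity)
  have ht : Tendsto (fun ε : ℝ => ‖v‖ * ε + Real.sqrt (ε * (H.cnegNorm 0 ξ ^ 2) ^ n)) (𝓝[>] 0)
      (𝓝 0) :=
    (Continuous.tendsto' (by fun_prop) _ _ (by simp)).mono_left nhdsWithin_le_nhds
  have hle : ‖inner ℂ v g - f (fun _ => ξ)‖ ≤ 0 := ge_of_tendsto ht (by
    filter_upwards [self_mem_nhdsWithin] with ε hε using key ε hε)
  exact sub_eq_zero.1 (norm_le_zero_iff.1 hle)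

end CountablyHilbert

/-! ### Functions entire along lines -/

/-- Second order remainder of an entire function bounded on a disc. -/
theorem norm_remainder_le {g : ℂ → ℂ} (hg : Differentiable ℂ g) {C : ℝ}
    (hC : ∀ z, ‖z‖ ≤ 3 → ‖g z‖ ≤ C) {h : ℂ} (hh : ‖h‖ ≤ 1) :
    ‖g h - g 0 - h * deriv g 0‖ ≤ C * ‖h‖ ^ 2 := by
  have cauchy : ∀ (f : ℂ → ℂ) (R : ℝ), Differentiable ℂ f → (∀ z, ‖z‖ ≤ R + 1 → ‖f z‖ ≤ C) →
      ∀ z, ‖z‖ ≤ R → ‖deriv f z‖ ≤ C := by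
    intro f R hf hb z hz
    have := Complex.norm_deriv_le_of_forall_mem_sphere_norm_le (c := z) (C := C) one_pos
      hf.diffContOnCl fun w hw => hb w ?_
    · simpa using this
    · rw [mem_sphere_iff_norm] at hw
      have := norm_le_norm_sub_add w z
      linarith
  have hg' : Differentiable ℂ (deriv g) := fun z =>
    ((hg.analyticAt z).deriv).differentiableAt
  have h1 : ∀ z, ‖z‖ ≤ 2 → ‖deriv g z‖ ≤ C := cauchy g 2 hg fun z hz => hC z (by linarith)
  have h2 : ∀ z, ‖z‖ ≤ 1 → ‖deriv (deriv g) z‖ ≤ C :=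
    cauchy (deriv g) 1 hg' fun z hz => h1 z (by linarith)
  have h3 : ∀ z, ‖z‖ ≤ 1 → ‖deriv g z - deriv g 0‖ ≤ C * ‖z‖ := by
    intro z hz
    have := (convex_closedBall (0 : ℂ) 1).norm_image_sub_le_of_norm_deriv_le (f := deriv g)
      (fun w _ => hg' w) (fun w hw => h2 w (by simpa using hw)) (x := 0) (y := z)
      (by simp) (by simpa using hz)
    simpa using this
  have hd : ∀ w, HasDerivAt (fun z => g z - z * deriv g 0) (deriv g w - deriv g 0) w := by
    intro w
    simpa using (hg w).hasDerivAt.fun_sub ((hasDerivAt_id w).mul_const (deriv g 0))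
  have h4 := (convex_closedBall (0 : ℂ) ‖h‖).norm_image_sub_le_of_norm_hasDerivWithin_le
    (f := fun z => g z - z * deriv g 0) (fun w _ => (hd w).hasDerivWithinAt) (C := C * ‖h‖)
    (fun w hw => ?_) (x := 0) (y := h) (by simp) (by simp)
  · have e : g h - g 0 - h * deriv g 0 = g h - h * deriv g 0 - (g 0 - 0 * deriv g 0) := by ring
    rw [e]
    refine h4.trans (le_of_eq ?_)
    rw [sub_zero]; ring
  · have hw' : ‖w‖ ≤ ‖h‖ := by simpa using hw
    have hC0 : 0 ≤ C := (norm_nonneg _).trans (hC 0 (by simp))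
    exact (h3 w (hw'.trans hh)).trans (mul_le_mul_of_nonneg_left hw' hC0)

section Entire

variable {V : Type*} [AddCommGroup V] [Module ℂ V]

/-- The functions on `V` which are entire along every complex line and bounded on the balls of the
seminorm `N`. -/
def boundedEntire (N : Seminorm ℂ V) : Submodule ℂ (V → ℂ) where
  carrier := {F | (∀ ξ η : V, Differentiable ℂ fun z : ℂ => F (z • ξ + η)) ∧
    ∀ R : ℝ, ∃ C : ℝ, ∀ ξ, N ξ ≤ R → ‖F ξ‖ ≤ C}
  zero_mem' := ⟨fun _ _ => differentiable_const 0, fun _ => ⟨0, fun _ _ => by simp⟩⟩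
  add_mem' := by
    rintro F G ⟨hF, hF'⟩ ⟨hG, hG'⟩
    refine ⟨fun ξ η => (hF ξ η).add (hG ξ η), fun R => ?_⟩
    obtain ⟨C, hC⟩ := hF' R
    obtain ⟨D, hD⟩ := hG' R
    exact ⟨C + D, fun ξ hξ => (norm_add_le _ _).trans (add_le_add (hC ξ hξ) (hD ξ hξ))⟩
  smul_mem' := by
    rintro c F ⟨hF, hF'⟩
    refine ⟨fun ξ η => (hF ξ η).const_smul c, fun R => ?_⟩
    obtain ⟨C, hC⟩ := hF' R
    exact ⟨‖c‖ * C, fun ξ hξ => (norm_smul_le _ _).trans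
      (mul_le_mul_of_nonneg_left (hC ξ hξ) (norm_nonneg c))⟩

/-- The derivative of `F` in the direction `η`. -/
noncomputable def dirDeriv (η : V) (F : V → ℂ) (ξ : V) : ℂ := deriv (fun z : ℂ => F (z • η + ξ)) 0

variable {N : Seminorm ℂ V} {F : V → ℂ}

theorem boundedEntire.exists_remainder_bound (hF : F ∈ boundedEntire N) (η : V) (R : ℝ) :
    ∃ C : ℝ, 0 ≤ C ∧ ∀ ξ, N ξ ≤ R → ∀ h : ℂ, ‖h‖ ≤ 1 →
      ‖F (h • η + ξ) - F ξ - h * dirDeriv η F ξ‖ ≤ C * ‖h‖ ^ 2 := by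
  obtain ⟨C, hC⟩ := hF.2 (3 * N η + R)
  refine ⟨max C 0, le_max_right _ _, fun ξ hξ h hh => ?_⟩
  have := norm_remainder_le (hF.1 η ξ) (C := max C 0) (fun z hz => ?_) hh
  · simpa [dirDeriv] using this
  · refine (hC _ ?_).trans (le_max_left _ _)
    refine (map_add_le_add N _ _).trans (add_le_add ?_ hξ)
    rw [map_smul_eq_mul]
    exact mul_le_mul_of_nonneg_right hz (apply_nonneg N η)

/-- The step of the difference quotients. -/
noncomputable def quotStep (n : ℕ) : ℂ := ((1 / ((n : ℝ) + 1) : ℝ) : ℂ)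

theorem norm_quotStep (n : ℕ) : ‖quotStep n‖ = 1 / ((n : ℝ) + 1) := by
  rw [quotStep, Complex.norm_real, Real.norm_of_nonneg Nat.one_div_pos_of_nat.le]

theorem quotStep_ne_zero (n : ℕ) : quotStep n ≠ 0 := by
  rw [← norm_pos_iff, norm_quotStep]; exact Nat.one_div_pos_of_nat

theorem tendsto_quotStep : Tendsto quotStep atTop (𝓝 0) := by
  rw [tendsto_zero_iff_norm_tendsto_zero]
  simp only [norm_quotStep]
  exact tendsto_one_div_add_atTop_nhds_zero_nat

/-- The difference quotient of `F` in the direction `η`. -/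
noncomputable def diffQuot (n : ℕ) (η : V) (F : V → ℂ) (ξ : V) : ℂ :=
  (quotStep n)⁻¹ * (F (quotStep n • η + ξ) - F ξ)

theorem boundedEntire.exists_diffQuot_bound (hF : F ∈ boundedEntire N) (η : V) (R : ℝ) :
    ∃ C : ℝ, ∀ ξ, N ξ ≤ R → ∀ n : ℕ,
      ‖diffQuot n η F ξ - dirDeriv η F ξ‖ ≤ C * (1 / ((n : ℝ) + 1)) := by
  obtain ⟨C, hC0, hC⟩ := exists_remainder_bound hF η R
  refine ⟨C, fun ξ hξ n => ?_⟩
  have h0 := quotStep_ne_zero n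
  have hn : ‖quotStep n‖ ≤ 1 := by
    rw [norm_quotStep, div_le_one (by positivity)]
    have : (0 : ℝ) ≤ n := Nat.cast_nonneg n
    linarith
  have h1 := hC ξ hξ (quotStep n) hn
  have h2 : diffQuot n η F ξ - dirDeriv η F ξ = (quotStep n)⁻¹ *
      (F (quotStep n • η + ξ) - F ξ - quotStep n * dirDeriv η F ξ) := by
    rw [diffQuot]; field_simp
  rw [h2, norm_mul, norm_inv, ← norm_quotStep]
  rw [inv_mul_le_iff₀ (norm_pos_iff.2 h0)]
  linarith

theorem boundedEntire.tendsto_diffQuot (hF : F ∈ boundedEntire N) (η ξ : V) :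
    Tendsto (fun n => diffQuot n η F ξ) atTop (𝓝 (dirDeriv η F ξ)) := by
  obtain ⟨C, hC⟩ := exists_diffQuot_bound hF η (N ξ)
  rw [tendsto_iff_norm_sub_tendsto_zero]
  refine squeeze_zero (fun _ => norm_nonneg _) (hC ξ le_rfl) ?_
  simpa using tendsto_one_div_add_atTop_nhds_zero_nat.const_mul C

/-- Along lines, the difference quotients converge locally uniformly. -/
theorem boundedEntire.tendstoLocallyUniformlyOn (hF : F ∈ boundedEntire N) (η ξ ζ : V) :
    TendstoLocallyUniformlyOn (fun n (z : ℂ) => diffQuot n η F (z • ξ + ζ))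
      (fun z => dirDeriv η F (z • ξ + ζ)) atTop Set.univ := by
  rw [tendstoLocallyUniformlyOn_univ, Metric.tendstoLocallyUniformly_iff]
  intro ε hε z₀
  obtain ⟨C, hC⟩ := exists_diffQuot_bound hF η ((‖z₀‖ + 1) * N ξ + N ζ)
  refine ⟨Metric.ball z₀ 1, Metric.ball_mem_nhds z₀ one_pos, ?_⟩
  have ht : Tendsto (fun n : ℕ => C * (1 / ((n : ℝ) + 1))) atTop (𝓝 0) := by
    simpa using tendsto_one_div_add_atTop_nhds_zero_nat.const_mul C
  filter_upwards [ht.eventually (gt_mem_nhds hε)] with n hn z hz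
  rw [dist_eq_norm, norm_sub_rev]
  refine (hC _ ?_ n).trans_lt hn
  refine (map_add_le_add N _ _).trans (add_le_add_left ?_ _)
  rw [map_smul_eq_mul]
  refine mul_le_mul_of_nonneg_right ?_ (apply_nonneg N ξ)
  have := norm_le_norm_sub_add z z₀
  rw [Metric.mem_ball, dist_eq_norm] at hz
  linarith

theorem boundedEntire.differentiable_diffQuot (hF : F ∈ boundedEntire N) (n : ℕ) (η ξ ζ : V) :
    Differentiable ℂ fun z : ℂ => diffQuot n η F (z • ξ + ζ) := by
  have h1 := hF.1 ξ (quotStep n • η + ζ)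
  have h2 := hF.1 ξ ζ
  have h3 : (fun z : ℂ => diffQuot n η F (z • ξ + ζ)) = fun z : ℂ =>
      (quotStep n)⁻¹ * (F (z • ξ + (quotStep n • η + ζ)) - F (z • ξ + ζ)) := by
    ext z
    rw [diffQuot, add_left_comm]
  rw [h3]
  exact (h1.sub h2).const_mul _

/-- The class is closed under directional derivatives: these are entire along lines as locally
uniform limits, and bounded on balls by Cauchy's estimate. -/
theorem boundedEntire.dirDeriv_mem (hF : F ∈ boundedEntire N) (η : V) :
    dirDeriv η F ∈ boundedEntire N := by
  refine ⟨fun ξ ζ => ?_, fun R => ?_⟩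
  · rw [← differentiableOn_univ]
    exact (tendstoLocallyUniformlyOn hF η ξ ζ).differentiableOn
      (Eventually.of_forall fun n => (differentiable_diffQuot hF n η ξ ζ).differentiableOn)
      isOpen_univ
  · obtain ⟨C, hC⟩ := hF.2 (N η + R)
    refine ⟨C, fun ξ hξ => ?_⟩
    have := Complex.norm_deriv_le_of_forall_mem_sphere_norm_le (c := 0) (C := C) one_pos
      (hF.1 η ξ).diffContOnCl fun w hw => hC _ ?_
    · simpa [dirDeriv] using this
    · refine (map_add_le_add N _ _).trans (add_le_add ?_ hξ)
      rw [map_smul_eq_mul, mem_sphere_zero_iff_norm.1 hw, one_mul]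

theorem dirDeriv_smul_left (c : ℂ) (η ξ : V) (hF : F ∈ boundedEntire N) :
    dirDeriv (c • η) F ξ = c * dirDeriv η F ξ := by
  have h : HasDerivAt (fun z : ℂ => F (z • η + ξ)) (dirDeriv η F ξ) (0 * c) := by
    rw [zero_mul]; exact (hF.1 η ξ 0).hasDerivAt
  have h2 := (h.comp (0 : ℂ) ((hasDerivAt_id (0 : ℂ)).mul_const c)).deriv
  simp only [Function.comp_def, id, mul_smul, one_mul] at h2
  rw [mul_comm, ← h2, dirDeriv]

theorem dirDeriv_add_left (η ζ ξ : V) (hF : F ∈ boundedEntire N) :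
    dirDeriv (η + ζ) F ξ = dirDeriv η F ξ + dirDeriv ζ F ξ := by
  have h1 := boundedEntire.tendsto_diffQuot hF (η + ζ) ξ
  have h2 := boundedEntire.tendsto_diffQuot hF η ξ
  -- increment along `ζ` after a small step along `η`
  have h3 : Tendsto (fun n => diffQuot n ζ F (quotStep n • η + ξ)) atTop
      (𝓝 (dirDeriv ζ F ξ)) := by
    have h4 := (boundedEntire.dirDeriv_mem hF ζ).1 η ξ
    have h5 := (boundedEntire.tendstoLocallyUniformlyOn hF ζ η ξ).tendsto_comp
      (h4 0).continuousAt.continuousWithinAt (Set.mem_univ 0)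
      (by rw [nhdsWithin_univ]; exact tendsto_quotStep)
    simpa using h5
  refine tendsto_nhds_unique h1 ((h2.add h3).congr fun n => ?_)
  simp only [diffQuot, smul_add]
  rw [show quotStep n • ζ + (quotStep n • η + ξ) = quotStep n • η + quotStep n • ζ + ξ by abel]
  ring

theorem dirDeriv_comm (η ζ ξ : V) (hF : F ∈ boundedEntire N) :
    dirDeriv η (dirDeriv ζ F) ξ = dirDeriv ζ (dirDeriv η F) ξ := by
  have h1 := ((boundedEntire.tendstoLocallyUniformlyOn hF ζ η ξ).deriv
    (Eventually.of_forall fun n =>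
      (boundedEntire.differentiable_diffQuot hF n ζ η ξ).differentiableOn)
    isOpen_univ).tendsto_at (Set.mem_univ 0)
  have h2 := boundedEntire.tendsto_diffQuot (boundedEntire.dirDeriv_mem hF η) ζ ξ
  refine tendsto_nhds_unique h1 (h2.congr fun n => ?_)
  have h3 : (fun z : ℂ => diffQuot n ζ F (z • η + ξ)) = fun z : ℂ =>
      (quotStep n)⁻¹ * (F (z • η + (quotStep n • ζ + ξ)) - F (z • η + ξ)) := by
    ext z
    rw [diffQuot, add_left_comm]
  rw [Function.comp_apply, h3, deriv_const_mul_field, deriv_fun_sub (hF.1 _ _ 0) (hF.1 _ _ 0)]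
  rfl

variable (N) in
/-- Directional differentiation as a linear map into the endomorphisms of the class. -/
noncomputable def dirDerivₗ : V →ₗ[ℂ] Module.End ℂ (boundedEntire N) where
  toFun η :=
    { toFun := fun F => ⟨dirDeriv η F, boundedEntire.dirDeriv_mem F.2 η⟩
      map_add' := fun F G => by
        ext ξ
        exact deriv_fun_add (F.2.1 η ξ 0) (G.2.1 η ξ 0)
      map_smul' := fun c F => by
        ext ξ
        exact deriv_const_mul_field c }
  map_add' η ζ := by
    ext F ξ
    exact dirDeriv_add_left η ζ ξ F.2
  map_smul' c η := by
    ext F ξ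
    exact dirDeriv_smul_left c η ξ F.2

theorem dirDerivₗ_apply (η : V) (F : boundedEntire N) (ξ : V) :
    (dirDerivₗ N η F : V → ℂ) ξ = dirDeriv η F ξ := rfl

theorem commute_dirDerivₗ (η ζ : V) : Commute (dirDerivₗ N η) (dirDerivₗ N ζ) := by
  ext F ξ
  exact dirDeriv_comm η ζ ξ F.2

/-! ### Taylor coefficients -/

/-- The `n`-th Taylor coefficient at `0`, as the multilinear form
`(η_1, …, η_n) ↦ (1 / n!) D_{η_1} ⋯ D_{η_n} F (0)`. -/
noncomputable def taylorForm (F : boundedEntire N) (n : ℕ) :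
    MultilinearMap ℂ (fun _ : Fin n => V) ℂ :=
  (n.factorial : ℂ)⁻¹ •
    (((LinearMap.proj (0 : V) : (V → ℂ) →ₗ[ℂ] ℂ) ∘ₗ (boundedEntire N).subtype ∘ₗ
      LinearMap.applyₗ F).compMultilinearMap
        ((MultilinearMap.mkPiAlgebraFin ℂ n (Module.End ℂ (boundedEntire N))).compLinearMap
          fun _ => dirDerivₗ N))

theorem taylorForm_apply (F : boundedEntire N) (n : ℕ) (η : Fin n → V) :
    taylorForm F n η =
      (n.factorial : ℂ)⁻¹ * (((List.ofFn η).map (dirDerivₗ N)).prod F : V → ℂ) 0 := by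
  rw [List.map_ofFn]
  rfl

theorem taylorForm_symm (F : boundedEntire N) (n : ℕ) (σ : Equiv.Perm (Fin n)) (η : Fin n → V) :
    taylorForm F n (fun k => η (σ k)) = taylorForm F n η := by
  rw [taylorForm_apply, taylorForm_apply]
  have h : ((List.ofFn fun k => η (σ k)).map (dirDerivₗ N)).Perm
      ((List.ofFn η).map (dirDerivₗ N)) := (Equiv.Perm.ofFn_comp_perm σ η).map _
  rw [h.prod_eq' ?_]
  refine List.pairwise_of_forall_mem_list ?_
  intro a ha b hb
  obtain ⟨x, -, rfl⟩ := List.mem_map.1 ha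
  obtain ⟨y, -, rfl⟩ := List.mem_map.1 hb
  exact commute_dirDerivₗ x y

theorem iteratedDeriv_line (F : boundedEntire N) (ξ : V) (n : ℕ) (w : ℂ) :
    iteratedDeriv n (fun z : ℂ => (F : V → ℂ) (z • ξ)) w =
      ((dirDerivₗ N ξ ^ n) F : V → ℂ) (w • ξ) := by
  induction n generalizing w with
  | zero => simp
  | succ n ih =>
    rw [iteratedDeriv_succ, funext ih, pow_succ', Module.End.mul_apply, dirDerivₗ_apply, dirDeriv]
    have := deriv_comp_add_const (fun z : ℂ => ((dirDerivₗ N ξ ^ n) F : V → ℂ) (z • ξ)) w 0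
    rw [zero_add] at this
    rw [← this]
    simp only [add_smul]

/-- The Taylor expansion at `0`. -/
theorem hasSum_taylorForm (F : boundedEntire N) (ξ : V) :
    HasSum (fun n => taylorForm F n fun _ => ξ) ((F : V → ℂ) ξ) := by
  have hd : Differentiable ℂ fun z : ℂ => (F : V → ℂ) (z • ξ) := by
    simpa using F.2.1 ξ 0
  have h := Complex.hasSum_taylorSeries_of_entire hd 0 1
  simp only [iteratedDeriv_line, zero_smul, one_smul, sub_zero, one_pow, smul_eq_mul] at h
  have e : (fun n => taylorForm F n fun _ => ξ) =
      fun n : ℕ => (n.factorial : ℂ)⁻¹ * (1 * ((dirDerivₗ N ξ ^ n) F : V → ℂ) 0) := by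
    ext n
    rw [taylorForm_apply, List.ofFn_const, List.map_replicate, List.prod_replicate, one_mul]
  rw [e]
  exact h

/-- Cauchy's estimate for iterated directional derivatives; the polydisc of polyradius
`s / N' η_j` lies in the ball of radius `n s`. -/
theorem norm_prod_dirDerivₗ_le (N' : Seminorm ℂ V) {s M : ℝ} (hs : 0 < s) (l : List V)
    (hl : ∀ η ∈ l, 0 < N' η) (F : boundedEntire N) (ξ₀ : V)
    (hM : ∀ ξ, N' (ξ - ξ₀) ≤ l.length * s → ‖(F : V → ℂ) ξ‖ ≤ M) :
    ‖((l.map (dirDerivₗ N)).prod F : V → ℂ) ξ₀‖ ≤ (l.map fun η => N' η / s).prod * M := by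
  induction l generalizing ξ₀ with
  | nil => simpa using hM ξ₀ (by simp)
  | cons η l ih =>
    have hη : 0 < N' η := hl η (by simp)
    have hR : 0 < s / N' η := div_pos hs hη
    simp only [List.map_cons, List.prod_cons, Module.End.mul_apply, dirDerivₗ_apply]
    have := Complex.norm_deriv_le_of_forall_mem_sphere_norm_le (c := 0)
      (C := (l.map fun η => N' η / s).prod * M) hR
      (((l.map (dirDerivₗ N)).prod F).2.1 η ξ₀).diffContOnCl fun w hw => ?_
    · refine this.trans (le_of_eq ?_)
      field_simp
    · refine ih (fun ζ hζ => hl ζ (by simp [hζ])) _ fun ξ hξ => hM ξ ?_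
      have h1 : ξ - ξ₀ = (ξ - (w • η + ξ₀)) + w • η := by abel
      rw [h1]
      refine (map_add_le_add N' _ _).trans ?_
      rw [map_smul_eq_mul, mem_sphere_zero_iff_norm.1 hw, div_mul_cancel₀ _ hη.ne',
        List.length_cons]
      push_cast
      linarith

end Entire

/-! ### The generating function -/

section GenInv

variable {α : ℕ → ℝ} (hα : CondA1 α)
include hα

theorem CondA1.pos (n : ℕ) : 0 < α n := by
  obtain ⟨-, c, hc, h⟩ := hα
  exact hc.trans_le (h n)

theorem CondA1.weight_pos (n : ℕ) : 0 < (n.factorial : ℝ) * α n :=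
  mul_pos (Nat.cast_pos.2 n.factorial_pos) (hα.pos n)

theorem CondA1.summable (r : ℝ) : Summable fun n : ℕ => 1 / ((n.factorial : ℝ) * α n) * r ^ n := by
  obtain ⟨-, c, hc, h⟩ := id hα
  refine Summable.of_norm_bounded (g := fun n : ℕ => c⁻¹ * (|r| ^ n / n.factorial))
    ((Real.summable_pow_div_factorial |r|).mul_left _) fun n => ?_
  have hn : (0 : ℝ) < n.factorial := Nat.cast_pos.2 n.factorial_pos
  rw [norm_mul, norm_pow, Real.norm_of_nonneg (one_div_pos.2 (hα.weight_pos n)).le,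
    Real.norm_eq_abs]
  calc 1 / ((n.factorial : ℝ) * α n) * |r| ^ n ≤ 1 / ((n.factorial : ℝ) * c) * |r| ^ n := by
        gcongr
        exact h n
    _ = c⁻¹ * (|r| ^ n / n.factorial) := by field_simp

theorem CondA1.genInv_nonneg {r : ℝ} (hr : 0 ≤ r) : 0 ≤ genInv α r :=
  tsum_nonneg fun n => mul_nonneg (one_div_pos.2 (hα.weight_pos n)).le (pow_nonneg hr n)

theorem CondA1.genInv_mono {r s : ℝ} (hr : 0 ≤ r) (hrs : r ≤ s) : genInv α r ≤ genInv α s :=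
  (hα.summable r).tsum_le_tsum (fun n => mul_le_mul_of_nonneg_left (pow_le_pow_left₀ hr hrs n)
    (one_div_pos.2 (hα.weight_pos n)).le) (hα.summable s)

theorem CondA1.exists_le_pow (hB : CondB1 α) : ∃ C : ℝ, 0 < C ∧ ∀ᶠ n : ℕ in atTop,
    (n.factorial : ℝ) * α n * ⨅ r : Set.Ioi (0 : ℝ), genInv α r / (r : ℝ) ^ n ≤ C ^ n := by
  obtain ⟨c, hc1, hc2⟩ := exists_between hB
  refine ⟨c.toReal + 1, by positivity, ?_⟩
  filter_upwards [eventually_lt_of_limsup_lt hc1, eventually_ge_atTop 1] with n hn hn1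
  set D := (n.factorial : ℝ) * α n * ⨅ r : Set.Ioi (0 : ℝ), genInv α r / (r : ℝ) ^ n
  have hD : 0 ≤ D := mul_nonneg (hα.weight_pos n).le (Real.iInf_nonneg fun r =>
    div_nonneg (hα.genInv_nonneg (le_of_lt r.2)) (pow_nonneg (le_of_lt r.2) n))
  have h1 : D ^ (1 / (n : ℝ)) < c.toReal :=
    (ENNReal.ofReal_lt_iff_lt_toReal (Real.rpow_nonneg hD _) hc2.ne).1 hn
  have h2 : (D ^ (1 / (n : ℝ))) ^ n = D := by
    rw [one_div]; exact Real.rpow_inv_natCast_pow hD (by omega)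
  rw [← h2]
  exact pow_le_pow_left₀ (Real.rpow_nonneg hD _) (by linarith) n

end GenInv

namespace CountablyHilbert

variable {E : Type*} [AddCommGroup E] [Module ℝ E] [UniformSpace E] {H : CountablyHilbert E}
  {μ : Measure (Dual E)}

/-! ### The `S`-transform of a chaos expansion -/

theorem differentiable_diagonal_line {n : ℕ}
    (f : MultilinearMap ℂ (fun _ : Fin n => Complexify E) ℂ) (ξ η : Complexify E) :
    Differentiable ℂ fun z : ℂ => f fun _ => z • ξ + η := by
  classical
  have h : (fun z : ℂ => f fun _ => z • ξ + η) = fun z : ℂ => ∑ s : Finset (Fin n),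
      z ^ s.card * f (s.piecewise (fun _ => ξ) fun _ => η) := by
    ext z
    have h1 := f.map_add_univ (fun _ => z • ξ) fun _ => η
    refine h1.trans (Finset.sum_congr rfl fun s _ => ?_)
    have h2 := f.map_piecewise_smul (fun _ => z) (s.piecewise (fun _ => ξ) fun _ => η) s
    rw [Finset.prod_const, smul_eq_mul] at h2
    rw [← h2]
    congr 1
    ext1 k
    by_cases hk : k ∈ s <;> simp [Finset.piecewise, hk]
  rw [h]
  fun_prop

theorem hasSum_sTransform (h0 : ∀ p ξ, H.norm 0 ξ ≤ H.norm p ξ) (hμ : H.IsStandardGaussian μ)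
    {φ : Lp ℂ 2 μ} {f : (n : ℕ) → MultilinearMap ℂ (fun _ : Fin n => Complexify E) ℂ}
    (hf : H.IsChaosExpansion μ φ f) (ξ : Complexify E) :
    HasSum (fun n => f n fun _ => ξ) (H.sTransform μ φ ξ) := by
  obtain ⟨-, g, hg, hs⟩ := hf
  have h := (innerSL ℂ (wickExpLp hμ ξ.conj)).hasSum hs
  simp only [innerSL_apply_apply, ← sTransform_eq_inner hμ] at h
  have e : (fun n => f n fun _ => ξ) = fun n => H.sTransform μ (g n) ξ :=
    funext fun n => ((hg n).sTransform_eq hμ h0 ξ).symm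
  rw [e]
  exact h

section Weights

variable {α : ℕ → ℝ} (hα : CondA1 α) {p : ℕ}
  {f : (n : ℕ) → MultilinearMap ℂ (fun _ : Fin n => Complexify E) ℂ}
  (hf : H.cksNormSq α p f < ∞)
include hα hf

theorem tensorNormSq_ne_top (n : ℕ) : H.tensorNormSq p (f n) ≠ ∞ := by
  intro h
  have h1 := ENNReal.le_tsum (f := fun n : ℕ =>
    ENNReal.ofReal ((n.factorial : ℝ) * α n) * H.tensorNormSq p (f n)) n
  simp only [h, ENNReal.mul_top (ENNReal.ofReal_pos.2 (hα.weight_pos n)).ne'] at h1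
  exact absurd (lt_of_le_of_lt h1 hf) (lt_irrefl _)

theorem hasSum_weight_mul_tensorNormSq :
    HasSum (fun n : ℕ => (n.factorial : ℝ) * α n * (H.tensorNormSq p (f n)).toReal)
      (H.cksNormSq α p f).toReal := by
  have h := ENNReal.hasSum_toReal hf.ne
  rw [← ENNReal.tsum_toReal_eq (fun n => ENNReal.ne_top_of_tsum_ne_top hf.ne n)] at h
  simpa only [cksNormSq, ENNReal.toReal_mul, ENNReal.toReal_ofReal (hα.weight_pos _).le] using h

/-- Each term of the expansion is bounded by a product of two square summable sequences. -/
theorem norm_diagonal_le_mul (h0 : ∀ p ξ, H.norm 0 ξ ≤ H.norm p ξ) (n : ℕ) (ξ : Complexify E)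
    {r : ℝ} (hr : H.cnegNorm p ξ ^ 2 ≤ r) :
    ‖f n fun _ => ξ‖ ≤
      Real.sqrt ((n.factorial : ℝ) * α n * (H.tensorNormSq p (f n)).toReal) *
        Real.sqrt (1 / ((n.factorial : ℝ) * α n) * r ^ n) := by
  have hw := hα.weight_pos n
  rw [← Real.sqrt_mul (mul_nonneg hw.le ENNReal.toReal_nonneg)]
  refine Real.le_sqrt_of_sq_le ((H.norm_sq_diagonal_le h0 (f n)
    (tensorNormSq_ne_top hα hf n) ξ).trans ?_)
  have h1 : (n.factorial : ℝ) * α n * (H.tensorNormSq p (f n)).toReal *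
      (1 / ((n.factorial : ℝ) * α n) * r ^ n) = (H.tensorNormSq p (f n)).toReal * r ^ n := by
    have := (hα.pos n).ne'
    field_simp
  rw [h1]
  exact mul_le_mul_of_nonneg_left (pow_le_pow_left₀ (sq_nonneg _) hr n) ENNReal.toReal_nonneg

theorem norm_le_of_hasSum_diagonal (h0 : ∀ p ξ, H.norm 0 ξ ≤ H.norm p ξ) {ξ : Complexify E} {s : ℂ}
    (hs : HasSum (fun n => f n fun _ => ξ) s) :
    ‖s‖ ≤ Real.sqrt (H.cksNormSq α p f).toReal * Real.sqrt (genInv α (H.cnegNorm p ξ ^ 2)) := by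
  refine le_of_tendsto hs.norm (Eventually.of_forall fun t => ?_)
  have hA := hasSum_weight_mul_tensorNormSq hα hf
  have hA0 : ∀ n : ℕ, 0 ≤ (n.factorial : ℝ) * α n * (H.tensorNormSq p (f n)).toReal := fun n =>
    mul_nonneg (hα.weight_pos n).le ENNReal.toReal_nonneg
  have hB0 : ∀ n : ℕ, 0 ≤ 1 / ((n.factorial : ℝ) * α n) * (H.cnegNorm p ξ ^ 2) ^ n := fun n =>
    mul_nonneg (one_div_pos.2 (hα.weight_pos n)).le (by positivity)
  refine (norm_sum_le _ _).trans ((Finset.sum_le_sum fun n _ =>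
    norm_diagonal_le_mul hα hf h0 n ξ le_rfl).trans ?_)
  refine (Real.sum_sqrt_mul_sqrt_le t hA0 hB0).trans ?_
  refine mul_le_mul (Real.sqrt_le_sqrt ?_) (Real.sqrt_le_sqrt ?_) (Real.sqrt_nonneg _)
    (Real.sqrt_nonneg _)
  · exact sum_le_hasSum t (fun n _ => hA0 n) hA
  · exact (hα.summable _).sum_le_tsum t (fun n _ => hB0 n)

theorem entireOnLines_of_hasSum (h0 : ∀ p ξ, H.norm 0 ξ ≤ H.norm p ξ) {F : Complexify E → ℂ}
    (hF : ∀ ξ, HasSum (fun n => f n fun _ => ξ) (F ξ)) : EntireOnLines F := by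
  intro ξ η z₀
  set R := (‖z₀‖ + 1) * H.cnegNorm p ξ + H.cnegNorm p η
  have hball : ∀ z ∈ Metric.ball z₀ 1, H.cnegNorm p (z • ξ + η) ≤ R := by
    intro z hz
    have h1 := map_add_le_add (H.cnegSeminorm h0 p) (z • ξ) η
    rw [map_smul_eq_mul] at h1
    refine h1.trans (add_le_add_left (mul_le_mul_of_nonneg_right ?_ (H.cnegNorm_nonneg p ξ)) _)
    have := norm_le_norm_sub_add z z₀
    rw [Metric.mem_ball, dist_eq_norm] at hz
    linarith
  have hsum : Summable fun n : ℕ =>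
      Real.sqrt ((n.factorial : ℝ) * α n * (H.tensorNormSq p (f n)).toReal) *
        Real.sqrt (1 / ((n.factorial : ℝ) * α n) * (R ^ 2) ^ n) := by
    refine Summable.of_nonneg_of_le (fun n => by positivity) (fun n => ?_)
      ((hasSum_weight_mul_tensorNormSq hα hf).summable.add (hα.summable (R ^ 2)))
    have hA0 : 0 ≤ (n.factorial : ℝ) * α n * (H.tensorNormSq p (f n)).toReal :=
      mul_nonneg (hα.weight_pos n).le ENNReal.toReal_nonneg
    have hB0 : 0 ≤ 1 / ((n.factorial : ℝ) * α n) * (R ^ 2) ^ n :=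
      mul_nonneg (one_div_pos.2 (hα.weight_pos n)).le (by positivity)
    nlinarith [Real.sq_sqrt hA0, Real.sq_sqrt hB0,
      sq_nonneg (Real.sqrt ((n.factorial : ℝ) * α n * (H.tensorNormSq p (f n)).toReal) -
        Real.sqrt (1 / ((n.factorial : ℝ) * α n) * (R ^ 2) ^ n))]
  have hd := Complex.differentiableOn_tsum_of_summable_norm (U := Metric.ball z₀ 1) hsum
    (F := fun n z => f n fun _ => z • ξ + η)
    (fun n => (differentiable_diagonal_line (f n) ξ η).differentiableOn) Metric.isOpen_ball
    (fun n z hz => norm_diagonal_le_mul hα hf h0 n _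
      (pow_le_pow_left₀ (H.cnegNorm_nonneg p _) (hball z hz) 2))
  have e : (fun z : ℂ => ∑' n, f n fun _ => z • ξ + η) = fun z => F (z • ξ + η) :=
    funext fun z => (hF _).tsum_eq
  rw [← e]
  exact hd.differentiableAt (Metric.ball_mem_nhds z₀ one_pos)

end Weights

/-- The chaos kernels, hence the element of `(L²)`, are determined by the `S`-transform. -/
theorem IsChaosExpansion.eq_of_sTransform_eq (h0 : ∀ p ξ, H.norm 0 ξ ≤ H.norm p ξ)
    (hμ : H.IsStandardGaussian μ) {φ ψ : Lp ℂ 2 μ}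
    {f g : (n : ℕ) → MultilinearMap ℂ (fun _ : Fin n => Complexify E) ℂ}
    (hf : H.IsChaosExpansion μ φ f) (hg : H.IsChaosExpansion μ ψ g)
    (h : ∀ ξ, H.sTransform μ φ ξ = H.sTransform μ ψ ξ) : φ = ψ := by
  have hdiag : ∀ n ξ, (f n fun _ => ξ) = g n fun _ => ξ := by
    intro n ξ
    have key : ∀ (χ : Lp ℂ 2 μ)
        (k : (n : ℕ) → MultilinearMap ℂ (fun _ : Fin n => Complexify E) ℂ),
        H.IsChaosExpansion μ χ k → ∀ z : ℂ,
        HasSum (fun n => (k n fun _ => ξ) * z ^ n) (H.sTransform μ χ (z • ξ)) := by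
      intro χ k hk z
      have h1 := hasSum_sTransform h0 hμ hk (z • ξ)
      have e : (fun n => k n fun _ => z • ξ) = fun n => (k n fun _ => ξ) * z ^ n := by
        ext n
        rw [(k n).map_smul_univ (fun _ => z)]
        simp [mul_comm]
      rwa [e] at h1
    refine congrFun (coeff_eq_of_hasSum (b := fun n => g n fun _ => ξ) (key φ f hf) fun z => ?_) n
    rw [h]
    exact key ψ g hg z
  have hfg : ∀ n, f n = g n := by
    intro n
    refine sub_eq_zero.1 (eq_zero_of_diagonal (f n - g n) (fun σ η => ?_) fun ξ => ?_)
    · rw [_root_.sub_apply, _root_.sub_apply, (hf.1 n).1, (hg.1 n).1]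
    · rw [_root_.sub_apply, hdiag, sub_self]
  obtain ⟨-, u, hu, hsu⟩ := hf
  obtain ⟨-, v, hv, hsv⟩ := hg
  have huv : u = v := funext fun n => (hu n).unique hμ (by rw [hfg n]; exact hv n)
  exact hsu.unique (huv ▸ hsv)

/-! ### Kernels from the growth condition -/

section Growth

variable (h0 : ∀ p ξ, H.norm 0 ξ ≤ H.norm p ξ) {α : ℕ → ℝ} (hα : CondA1 α)
  {F : Complexify E → ℂ}
include h0 hα

theorem GrowthCondition.mem_boundedEntire (hF : EntireOnLines F) (hG : H.GrowthCondition α F) :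
    F ∈ boundedEntire (H.cnegSeminorm h0 0) := by
  refine ⟨hF, fun R => ?_⟩
  obtain ⟨K, hK0, hK⟩ := hG 1 0 one_pos
  refine ⟨K * Real.sqrt (genInv α (1 * R ^ 2)), fun ξ hξ => (hK ξ).trans ?_⟩
  have hξ' : H.cnegNorm 0 ξ ≤ R := hξ
  have h1 : H.cnegNorm 0 ξ ^ 2 ≤ R ^ 2 := pow_le_pow_left₀ (H.cnegNorm_nonneg 0 ξ) hξ' 2
  exact mul_le_mul_of_nonneg_left (Real.sqrt_le_sqrt (hα.genInv_mono (by positivity)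
    (by linarith))) hK0

/-- Cauchy's estimate on the polydisc of polyradius `s / |η_k|_{-q}`, with
`a ((n + 1) s)² = r`; using `n + 1` in place of `n` covers `n = 0`. -/
theorem norm_sq_taylorForm_le {q : ℕ} {a K : ℝ} (ha : 0 < a) (hK0 : 0 ≤ K)
    (hK : ∀ ξ, ‖F ξ‖ ≤ K * Real.sqrt (genInv α (a * H.cnegNorm q ξ ^ 2)))
    (hF : F ∈ boundedEntire (H.cnegSeminorm h0 0)) (n : ℕ) (η : Fin n → Complexify E)
    (hη : ∀ k, 0 < H.cnegNorm q (η k)) {r : ℝ} (hr : 0 < r) :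
    ‖taylorForm ⟨F, hF⟩ n η‖ ^ 2 ≤ (Real.exp (n + 1) ^ 2 * K ^ 2 * a ^ n *
      ∏ k, H.cnegNorm q (η k) ^ 2) * (genInv α r / r ^ n) := by
  set s := Real.sqrt (r / a) / (n + 1) with hs_def
  have hn1 : (0 : ℝ) < n + 1 := by positivity
  have hs : 0 < s := div_pos (Real.sqrt_pos.2 (div_pos hr ha)) hn1
  have hs2 : s ^ 2 = r / (a * (n + 1) ^ 2) := by
    rw [hs_def, div_pow, Real.sq_sqrt (div_pos hr ha).le]; field_simp
  have h1 := norm_prod_dirDerivₗ_le (N := H.cnegSeminorm h0 0) (H.cnegSeminorm h0 q) hs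
    (M := K * Real.sqrt (genInv α r)) (List.ofFn η)
    (fun ζ hζ => by obtain ⟨k, rfl⟩ := List.mem_ofFn.1 hζ; exact hη k) ⟨F, hF⟩ 0 (fun ξ hξ => by
      rw [sub_zero, List.length_ofFn, cnegSeminorm_apply] at hξ
      refine (hK ξ).trans (mul_le_mul_of_nonneg_left (Real.sqrt_le_sqrt
        (hα.genInv_mono (by positivity) ?_)) hK0)
      have h2 : H.cnegNorm q ξ ≤ (n + 1) * s := hξ.trans (by nlinarith)
      have h3 := pow_le_pow_left₀ (H.cnegNorm_nonneg q ξ) h2 2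
      rw [mul_pow, hs2] at h3
      calc a * H.cnegNorm q ξ ^ 2 ≤ a * ((n + 1) ^ 2 * (r / (a * (n + 1) ^ 2))) :=
            mul_le_mul_of_nonneg_left h3 ha.le
        _ = r := by field_simp)
  have hprod : ((List.ofFn η).map fun ζ => H.cnegSeminorm h0 q ζ / s).prod =
      ∏ k, H.cnegNorm q (η k) / s := by
    rw [List.map_ofFn, List.prod_ofFn]; rfl
  rw [hprod] at h1
  rw [taylorForm_apply, norm_mul, norm_inv, Complex.norm_natCast, mul_pow]
  have h4 := pow_le_pow_left₀ (_root_.norm_nonneg _) h1 2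
  refine (mul_le_mul_of_nonneg_left h4 (by positivity)).trans ?_
  have hG := hα.genInv_nonneg hr.le
  rw [mul_pow, mul_pow K, Real.sq_sqrt hG, ← Finset.prod_pow]
  simp only [div_pow]
  rw [Finset.prod_div_distrib, Finset.prod_const, Finset.card_univ, Fintype.card_fin, hs2]
  set P := ∏ k, H.cnegNorm q (η k) ^ 2 with hP
  have hP0 : 0 ≤ P := Finset.prod_nonneg fun k _ => sq_nonneg _
  -- `(n + 1) ^ n / n! = (n + 1) ^ (n + 1) / (n + 1)!` is a term of the series of `exp (n + 1)`
  have hexp : ((n : ℝ) + 1) ^ n / n.factorial ≤ Real.exp (n + 1) := by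
    have h5 := Real.pow_div_factorial_le_exp (x := (n : ℝ) + 1) hn1.le (n + 1)
    rw [Nat.factorial_succ, pow_succ] at h5
    push_cast at h5
    rwa [mul_comm ((n : ℝ) + 1) (n.factorial : ℝ), mul_div_mul_right _ _ hn1.ne'] at h5
  have hfac : (0 : ℝ) < n.factorial := Nat.cast_pos.2 n.factorial_pos
  have h6 : ((n.factorial : ℝ)⁻¹) ^ 2 * (P / (r / (a * (n + 1) ^ 2)) ^ n * (K ^ 2 * genInv α r)) =
      (((n : ℝ) + 1) ^ n / n.factorial) ^ 2 * (K ^ 2 * a ^ n * P * (genInv α r / r ^ n)) := by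
    rw [div_pow r, mul_pow, div_pow, ← pow_mul, ← pow_mul, mul_comm 2 n]
    field_simp
  rw [h6]
  have h7 := pow_le_pow_left₀ (by positivity) hexp 2
  refine (mul_le_mul_of_nonneg_right h7 (by positivity)).trans (le_of_eq ?_)
  ring

/-- Passing from `|·|_{-q}` to `|·|_{-p}` turns the pointwise bound into a Hilbert-Schmidt bound. -/
theorem tensorNormSq_taylorForm_le {p q : ℕ} (hq : H.hsNormSq q p < 1) {a K : ℝ} (ha : 0 < a)
    (hK0 : 0 ≤ K) (hK : ∀ ξ, ‖F ξ‖ ≤ K * Real.sqrt (genInv α (a * H.cnegNorm q ξ ^ 2)))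
    (hF : F ∈ boundedEntire (H.cnegSeminorm h0 0)) (n : ℕ) :
    H.tensorNormSq p (taylorForm ⟨F, hF⟩ n) ≤ ENNReal.ofReal
      (Real.exp (n + 1) ^ 2 * K ^ 2 * a ^ n *
        ⨅ r : Set.Ioi (0 : ℝ), genInv α r / (r : ℝ) ^ n) := by
  refine H.tensorNormSq_le _ fun m e he => ENNReal.ofReal_le_ofReal ?_
  have hpos : ∀ j, 0 < H.cnegNorm q (Complexify.ofReal (e j)) := by
    intro j
    rw [cnegNorm_ofReal]
    refine H.negNorm_pos h0 q fun h => ?_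
    have := he (Pi.single j 1)
    simp [Pi.single_apply, ite_smul, h, negNorm_apply_zero] at this
  have hsum : ∀ r : Set.Ioi (0 : ℝ), ∑ i : Fin n → Fin m,
      ‖taylorForm ⟨F, hF⟩ n fun k => Complexify.ofReal (e (i k))‖ ^ 2 ≤
        Real.exp (n + 1) ^ 2 * K ^ 2 * a ^ n * (genInv α r / (r : ℝ) ^ n) := by
    intro r
    have hr : 0 < (r : ℝ) := r.2
    have hG : 0 ≤ genInv α r / (r : ℝ) ^ n := div_nonneg (hα.genInv_nonneg hr.le) (by positivity)
    have hprod : ∑ i : Fin n → Fin m, ∏ k, H.cnegNorm q (Complexify.ofReal (e (i k))) ^ 2 ≤ 1 := by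
      have h1 := Fintype.sum_pow (fun j => H.cnegNorm q (Complexify.ofReal (e j)) ^ 2) n
      rw [← h1]
      refine pow_le_one₀ (Finset.sum_nonneg fun _ _ => sq_nonneg _) ?_
      simp only [cnegNorm_ofReal]
      exact H.sum_negNorm_sq_le_one h0 hq he
    calc _ ≤ ∑ i : Fin n → Fin m, (Real.exp (n + 1) ^ 2 * K ^ 2 * a ^ n *
          ∏ k, H.cnegNorm q (Complexify.ofReal (e (i k))) ^ 2) * (genInv α r / (r : ℝ) ^ n) :=
          Finset.sum_le_sum fun i _ => norm_sq_taylorForm_le h0 hα ha hK0 hK hF n _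
            (fun k => hpos (i k)) hr
      _ = (Real.exp (n + 1) ^ 2 * K ^ 2 * a ^ n * (genInv α r / (r : ℝ) ^ n)) *
          ∑ i : Fin n → Fin m, ∏ k, H.cnegNorm q (Complexify.ofReal (e (i k))) ^ 2 := by
          rw [Finset.mul_sum]
          exact Finset.sum_congr rfl fun i _ => by ring
      _ ≤ _ := mul_le_of_le_one_right (by positivity) hprod
  rw [Real.mul_iInf_of_nonneg (by positivity)]
  exact le_ciInf hsum

/-- Under (B̃1) the weighted norms of the Taylor coefficients decay geometrically. -/
theorem exists_taylorForm_decay (hb : ∀ p : ℕ, ∃ q : ℕ, p < q ∧ H.hsNormSq q p < 1)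
    (hB : CondB1 α) (hG : H.GrowthCondition α F)
    (hF : F ∈ boundedEntire (H.cnegSeminorm h0 0)) (p : ℕ) :
    ∃ L : ℝ, (∀ n, H.tensorNormSq p (taylorForm ⟨F, hF⟩ n) ≠ ∞) ∧ ∀ᶠ n : ℕ in atTop,
      (n.factorial : ℝ) * α n * (H.tensorNormSq p (taylorForm ⟨F, hF⟩ n)).toReal ≤
        L * (1 / 4) ^ n := by
  obtain ⟨q, -, hq⟩ := hb p
  obtain ⟨C, hC, hCn⟩ := hα.exists_le_pow hB
  -- chosen so that `e² a C = 1 / 4`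
  set a : ℝ := 1 / (4 * Real.exp 1 ^ 2 * C) with ha_def
  have he := Real.exp_pos 1
  have ha : 0 < a := by positivity
  obtain ⟨K, hK0, hK⟩ := hG a q ha
  have hle := tensorNormSq_taylorForm_le h0 hα hq ha hK0 hK hF
  refine ⟨Real.exp 1 ^ 2 * K ^ 2, fun n => ((hle n).trans_lt ENNReal.ofReal_lt_top).ne, ?_⟩
  filter_upwards [hCn] with n hn
  have hI : 0 ≤ ⨅ r : Set.Ioi (0 : ℝ), genInv α r / (r : ℝ) ^ n := Real.iInf_nonneg fun r =>
    div_nonneg (hα.genInv_nonneg (le_of_lt r.2)) (pow_nonneg (le_of_lt r.2) n)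
  have h1 := ENNReal.toReal_le_of_le_ofReal (by positivity) (hle n)
  have h2 : Real.exp (n + 1) ^ 2 * K ^ 2 * a ^ n * C ^ n = Real.exp 1 ^ 2 * K ^ 2 * (1 / 4) ^ n := by
    have h3 : Real.exp (n + 1) = Real.exp 1 ^ n * Real.exp 1 := by
      rw [Real.exp_add, Real.exp_one_pow]
    have h4 : (Real.exp 1 ^ n) ^ 2 * a ^ n * C ^ n = (1 / 4) ^ n := by
      rw [← pow_mul, mul_comm n 2, pow_mul, ← mul_pow, ← mul_pow, ha_def]
      congr 1
      field_simp
    rw [h3, ← h4]; ring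
  calc _ ≤ (n.factorial : ℝ) * α n * (Real.exp (n + 1) ^ 2 * K ^ 2 * a ^ n *
        ⨅ r : Set.Ioi (0 : ℝ), genInv α r / (r : ℝ) ^ n) :=
        mul_le_mul_of_nonneg_left h1 (hα.weight_pos n).le
    _ = (Real.exp (n + 1) ^ 2 * K ^ 2 * a ^ n) * ((n.factorial : ℝ) * α n *
        ⨅ r : Set.Ioi (0 : ℝ), genInv α r / (r : ℝ) ^ n) := by ring
    _ ≤ (Real.exp (n + 1) ^ 2 * K ^ 2 * a ^ n) * C ^ n :=
        mul_le_mul_of_nonneg_left hn (by positivity)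
    _ = _ := h2

theorem exists_mem_testSpace (hμ : H.IsStandardGaussian μ)
    (hb : ∀ p : ℕ, ∃ q : ℕ, p < q ∧ H.hsNormSq q p < 1) (hB : CondB1 α)
    (hE : EntireOnLines F) (hG : H.GrowthCondition α F) :
    ∃ φ : Lp ℂ 2 μ, φ ∈ H.testSpace α μ ∧ ∀ ξ, F ξ = H.sTransform μ φ ξ := by
  have hF := GrowthCondition.mem_boundedEntire h0 hα hE hG
  set f : (n : ℕ) → MultilinearMap ℂ (fun _ : Fin n => Complexify E) ℂ := taylorForm ⟨F, hF⟩ with hf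
  have hdecay := exists_taylorForm_decay h0 hα hb hB hG hF
  have hsym : ∀ n, H.IsSymTensor (f n) := fun n =>
    ⟨fun σ η => taylorForm_symm _ n σ η, by
      obtain ⟨L, hL, -⟩ := hdecay 0
      exact (hL n).lt_top⟩
  choose g hg hgn using fun n => exists_isWienerIntegral hμ (hsym n)
  have hsum : Summable g := by
    obtain ⟨L, -, hL⟩ := hdecay 0
    obtain ⟨-, c, hc, hcα⟩ := id hα
    refine Summable.of_norm_bounded_eventually_nat
      (g := fun n => Real.sqrt (2 / c * L) * (1 / 2) ^ n)
      ((summable_geometric_of_lt_one (by norm_num) (by norm_num)).mul_left _) ?_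
    filter_upwards [hL] with n hn
    have hT : 0 ≤ (n.factorial : ℝ) * (H.tensorNormSq 0 (f n)).toReal := by positivity
    have h1 : ‖g n‖ ^ 2 ≤ 2 / c * (L * (1 / 4) ^ n) := by
      refine (hgn n).trans ?_
      rw [div_mul_eq_mul_div, le_div_iff₀ hc]
      have h2 : (n.factorial : ℝ) * (H.tensorNormSq 0 (f n)).toReal * c ≤
          (n.factorial : ℝ) * (H.tensorNormSq 0 (f n)).toReal * α n :=
        mul_le_mul_of_nonneg_left (hcα n) hT
      nlinarith
    have h3 : 2 / c * (L * (1 / 4) ^ n) = (2 / c * L) * ((1 / 2) ^ n) ^ 2 := by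
      rw [← pow_mul, mul_comm n 2, pow_mul]; norm_num; ring
    rw [h3] at h1
    have h4 := Real.le_sqrt_of_sq_le h1
    rwa [Real.sqrt_mul' _ (by positivity), Real.sqrt_sq (by positivity)] at h4
  have hchaos : H.IsChaosExpansion μ (∑' n, g n) f := ⟨hsym, g, hg, hsum.hasSum⟩
  refine ⟨∑' n, g n, Set.mem_iInter.2 fun p => ⟨f, hchaos, ?_⟩, fun ξ => ?_⟩
  · obtain ⟨L, hfin, hL⟩ := hdecay p
    have hs : Summable fun n : ℕ =>
        (n.factorial : ℝ) * α n * (H.tensorNormSq p (f n)).toReal := by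
      refine Summable.of_norm_bounded_eventually_nat (g := fun n => L * (1 / 4) ^ n)
        ((summable_geometric_of_lt_one (by norm_num) (by norm_num)).mul_left _) ?_
      filter_upwards [hL] with n hn
      rwa [Real.norm_of_nonneg (mul_nonneg (hα.weight_pos n).le ENNReal.toReal_nonneg)]
    rw [cksNormSq]
    have e : (fun n : ℕ => ENNReal.ofReal ((n.factorial : ℝ) * α n) * H.tensorNormSq p (f n)) =
        fun n : ℕ => ENNReal.ofReal
          ((n.factorial : ℝ) * α n * (H.tensorNormSq p (f n)).toReal) := by
      ext n
      rw [ENNReal.ofReal_mul (hα.weight_pos n).le, ENNReal.ofReal_toReal (hfin n)]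
    rw [e]
    exact hs.tsum_ofReal_lt_top
  · exact (hasSum_taylorForm ⟨F, hF⟩ ξ).unique (hasSum_sTransform h0 hμ hchaos ξ)

end Growth

end CountablyHilbert

end CKS

open CKS in
theorem theorem2 {E : Type*} [AddCommGroup E] [Module ℝ E] [UniformSpace E] [IsUniformAddGroup E]
    [CompleteSpace E] (H : CountablyHilbert E)
    (ρ : ℝ) (hρ0 : 0 < ρ) (hρ1 : ρ < 1)
    (ha : ∀ (p : ℕ) (ξ : E), H.norm p ξ ≤ ρ * H.norm (p + 1) ξ)
    (hb : ∀ p : ℕ, ∃ q : ℕ, p < q ∧ H.hsNormSq q p < 1)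
    (μ : MeasureTheory.Measure (Dual E)) (hμ : H.IsStandardGaussian μ)
    (α : ℕ → ℝ) (hα : CondA1 α) :
    (∀ φ ∈ H.testSpace α μ,
      EntireOnLines (H.sTransform μ φ) ∧ H.GrowthCondition α (H.sTransform μ φ)) ∧
    (CondB1 α → ∀ F : Complexify E → ℂ, EntireOnLines F → H.GrowthCondition α F →
      ∃! φ : MeasureTheory.Lp ℂ 2 μ, φ ∈ H.testSpace α μ ∧ ∀ ξ, F ξ = H.sTransform μ φ ξ) := by
  have h0 : ∀ p ξ, H.norm 0 ξ ≤ H.norm p ξ := by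
    intro p ξ
    induction p with
    | zero => exact le_rfl
    | succ p ih =>
      exact ih.trans ((ha p ξ).trans (mul_le_of_le_one_left (H.norm_nonneg _ ξ) hρ1.le))
  refine ⟨fun φ hφ => ⟨?_, ?_⟩, fun hB F hE hG => ?_⟩
  · obtain ⟨f, hf, hfin⟩ := Set.mem_iInter.1 hφ 0
    exact CountablyHilbert.entireOnLines_of_hasSum hα hfin h0
      (CountablyHilbert.hasSum_sTransform h0 hμ hf)
  · intro a p ha0
    -- membership `k` levels higher gains the factor `ρ ^ k` in the argument
    obtain ⟨k, hk⟩ := exists_pow_lt_of_lt_one ha0 (pow_lt_one₀ hρ0.le hρ1 two_ne_zero)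
    obtain ⟨f, hf, hfin⟩ := Set.mem_iInter.1 hφ (p + k)
    refine ⟨_, Real.sqrt_nonneg _, fun ξ => (CountablyHilbert.norm_le_of_hasSum_diagonal hα hfin h0
      (CountablyHilbert.hasSum_sTransform h0 hμ hf ξ)).trans (mul_le_mul_of_nonneg_left
        (Real.sqrt_le_sqrt (hα.genInv_mono (sq_nonneg _) ?_)) (Real.sqrt_nonneg _))⟩
    have h1 := pow_le_pow_left₀ (H.cnegNorm_nonneg _ ξ)
      (H.cnegNorm_add_le_pow h0 hρ0.le ha p k ξ) 2
    refine h1.trans ?_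
    rw [mul_pow, ← pow_mul, mul_comm k 2, pow_mul]
    exact mul_le_mul_of_nonneg_right hk.le (sq_nonneg _)
  · obtain ⟨φ, hφ, hS⟩ := CountablyHilbert.exists_mem_testSpace h0 hα hμ hb hB hE hG
    refine ⟨φ, ⟨hφ, hS⟩, fun ψ hψ => ?_⟩
    obtain ⟨f, hf, -⟩ := Set.mem_iInter.1 hφ 0
    obtain ⟨g, hg, -⟩ := Set.mem_iInter.1 hψ.1 0
    exact hg.eq_of_sTransform_eq h0 hμ hf fun ξ => by rw [← hψ.2, ← hS]
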